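/- **Theorem 2.** Let $\|f\|_s=\big(\int_0^{2\pi}|f(t)|^s\,dt\big)^{1/s}$ for $2\pi$-periodic $f$ and $1\le s<\infty$. For $\alpha>0$, $0<r<1$, $\beta\in\mathbb R$ put $P_{\alpha,r,\beta}(t)=\sum_{k=1}^{\infty}e^{-\alpha k^{r}}\cos\big(kt-\tfrac{\beta\pi}{2}\big)$, and let $C^{\alpha,r}_{\beta,1}$ be the class of all $2\pi$-periodic functions $f$ that can be written, for all $x\in\mathbb R$, as $$f(x)=\frac{a_0}{2}+\frac1\pi\int_{-\pi}^{\pi}P_{\alpha,r,\beta}(x-t)\varphi(t)\,dt,$$ with some $a_0\in\mathbb R$ and some real $2\pi$-periodic $\varphi\in L_1$ such that $\|\varphi\|_1\le 1$ and $\int_0^{2\pi}\varphi(t)\,dt=0$. For $n\ge1$ let $$\mathcal E_n(C^{\alpha,r}_{\beta,1})_s=\sup_{f\in C^{\alpha,r}_{\beta,1}}\|f-S_{n-1}(f)\|_s,$$ where $S_{n-1}(f)$ is the partial Fourier sum of $f$ of order $n-1$. For $1<p<\infty$ let $n_0(\alpha,r,p)$ be the least positive integer $n$ such that $$\frac{1}{\alpha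 r}\frac1{n^{r}}+\frac{\alpha r\,p}{n^{1-r}}\le\frac1{(3\pi)^3}\cdot\frac{p-1}{p}.$$ Let $0<r<1$, $1<s<\infty$, $\frac1s+\frac1{s'}=1$, $\alpha>0$, $\beta\in\mathbb R$. Then for every integer $n\ge n_0(\alpha,r,s')$ the quantity $\mathcal E_n(C^{\alpha,r}_{\beta,1})_s$ is finite and $$\mathcal E_n(C^{\alpha,r}_{\beta,1})_s=e^{-\alpha n^{r}}n^{\frac{1-r}{s'}}\Bigg(\frac{\|\cos t\|_s}{\pi^{1+\frac1s}(\alpha r)^{\frac1{s'}}}F^{\frac1s}\Big(\frac12,\frac{3-s}2;\frac32;1\Big)+\gamma\Big(\Big(1+\frac{(\alpha r)^{\frac{s-1}{s'}}}{s-1}\Big)\frac1{n^{\frac{1-r}{s'}}}+\frac{(s')^{\frac1s}}{(\alpha r)^{1+\frac1{s'}}}\frac1{n^{r}}\Big)\Bigg),$$ where $F(a,b;c;z)=1+\sum_{k\ge1}\frac{(a)_k(b)_k}{(c)_k}\frac{z^k}{k!}$, $(x)_k=x(x+1)\cdots(x+k-1)$, is the Gauss hypergeometric function and the number $\gamma=\gamma_{n,s}(\alpha,r,\beta)$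 satisfies $|\gamma|\le(14\pi)^2$. -/

import Mathlib

open Real MeasureTheory Set
open scoped ENNReal

noncomputable section

namespace PoissonFourier

/-- The norm `‖f‖_s` of a `2π`-periodic function: the `L_s`-norm on `[0, 2π)` with respect to
Lebesgue measure (not normalized), `1 ≤ s ≤ ∞`, with values in `[0, ∞]`. -/
def periodNorm (s : ℝ≥0∞) (f : ℝ → ℝ) : ℝ≥0∞ :=
  eLpNorm f s (volume.restrict (Ico 0 (2 * π)))

/-- The set `B_p^0` of `2π`-periodic functions `φ ∈ L_p` with `‖φ‖_p ≤ 1` and `φ ⊥ 1`. -/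
def unitBallZeroMean (p : ℝ≥0∞) : Set (ℝ → ℝ) :=
  {φ | Function.Periodic φ (2 * π) ∧
    MemLp φ p (volume.restrict (Ico 0 (2 * π))) ∧
    periodNorm p φ ≤ 1 ∧
    ∫ t in (0 : ℝ)..(2 * π), φ t = 0}

/-- The generalized Poisson kernel
`P_{α,r,β}(t) = ∑_{k ≥ 1} e^{-α k^r} cos (k t - β π / 2)`. -/
def poissonKernel (α r β t : ℝ) : ℝ :=
  ∑' k : ℕ, exp (-α * ((k : ℝ) + 1) ^ r) * cos (((k : ℝ) + 1) * t - β * π / 2)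

/-- The class `C^{α,r}_{β,p}` of generalized Poisson integrals: the `2π`-periodic functions with
`f x = a₀ / 2 + (1 / π) ∫_{-π}^{π} P_{α,r,β}(x - t) φ(t) dt` for all real `x`, for some real `a₀`
and some `φ ∈ B_p^0`. -/
def poissonClass (α r β : ℝ) (p : ℝ≥0∞) : Set (ℝ → ℝ) :=
  {f | Function.Periodic f (2 * π) ∧
    ∃ a₀ : ℝ, ∃ φ ∈ unitBallZeroMean p, ∀ x : ℝ,
      f x = a₀ / 2 + 1 / π * ∫ t in (-π)..π, poissonKernel α r β (x - t) * φ t}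

/-- The Fourier cosine coefficient `a_k(f)`. -/
def fourierCosCoeff (f : ℝ → ℝ) (k : ℕ) : ℝ :=
  1 / π * ∫ t in (-π)..π, f t * cos ((k : ℝ) * t)

/-- The Fourier sine coefficient `b_k(f)`. -/
def fourierSinCoeff (f : ℝ → ℝ) (k : ℕ) : ℝ :=
  1 / π * ∫ t in (-π)..π, f t * sin ((k : ℝ) * t)

/-- The partial Fourier sum `S_m(f; x)` of order `m`. -/
def fourierSum (m : ℕ) (f : ℝ → ℝ) (x : ℝ) : ℝ :=
  fourierCosCoeff f 0 / 2 +
    ∑ k ∈ Finset.Icc 1 m,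
      (fourierCosCoeff f k * cos ((k : ℝ) * x) + fourierSinCoeff f k * sin ((k : ℝ) * x))

/-- The quantity `𝓔_n(C^{α,r}_{β,p})_s = sup ‖f - S_{n-1}(f)‖_s` over `f ∈ C^{α,r}_{β,p}`
(for `n ≥ 1`), as a supremum in `[0, ∞]`. -/
def fourierDeviation (α r β : ℝ) (p s : ℝ≥0∞) (n : ℕ) : ℝ≥0∞ :=
  ⨆ f ∈ poissonClass α r β p, periodNorm s (fun x => f x - fourierSum (n - 1) f x)

open Classical in
/-- The factor `χ(p)`: equal to `p` for finite `p`, and to `1` for `p = ∞`. -/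
def chi (p : ℝ≥0∞) : ℝ := if p = ∞ then 1 else p.toReal

open Classical in
/-- The bound on the right-hand side of the inequality that defines `n₀`. -/
def nZeroBound (p : ℝ≥0∞) : ℝ :=
  if p = 1 then 1 / 14
  else if p = ∞ then 1 / (3 * π) ^ 3
  else 1 / (3 * π) ^ 3 * ((p.toReal - 1) / p.toReal)

/-- `n₀(α, r, p)`: the least positive integer `n` with
`1 / (α r n^r) + α r χ(p) / n^{1-r} ≤ nZeroBound p`. Such `n` exist when `α > 0`, `0 < r < 1` and
`p ≥ 1`. -/
def nZero (α r : ℝ) (p : ℝ≥0∞) : ℕ :=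
  sInf {n : ℕ | 1 ≤ n ∧
    1 / (α * r) * (1 / (n : ℝ) ^ r) + α * r * chi p / (n : ℝ) ^ (1 - r) ≤ nZeroBound p}

end PoissonFourier

end

/-! Write `a = α r n^{r-1}` for the slope of the exponent at `n`, and let `T` be the part of the
kernel with frequencies at least `n`. The partial sum `S_{n-1}` reproduces what the head of the
kernel contributes and annihilates the rest, so `f - S_{n-1} f` is `1/π` times the convolution of
`T` with `φ` (`sub_fourierSum_eq`).

The supremum over `φ` is about `‖T‖_s / π`. Young's inequality gives the upper bound
(`circleNorm_convolution_le`). For the lower bound, a single point mass would be extremal but has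
nonzero mean; instead dipoles approximate half the difference of the masses at `0` and `h`
(`circleNorm_sub_shift_le_fourierDeviation`). With `h = π/n` the carrier of frequency `n` changes
sign, so `T - T(· - h)` is nearly `2T` and nothing is lost to leading order
(`fourierDeviation_bounds`).

To compute `‖T‖_s`, write `T(t) = e^{-α n^r} Re (e^{i(nt - θ)} G(t))`, where `G` varies slowly on
the scale `1/n`. A change of the phase `θ` can be traded for a translation of length `O(1/n)`, so
the norm hardly depends on `θ`; its `s`-th power averaged over `θ` is exactly a product of the norms
of `cos` and `G` (`circleNorm_modulated_bounds`).

It remains to find `‖G‖_s`. The coefficients of `G` lie close to `e^{-aj}`, so `G` is close to `1/(1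
- e^{-a+it})`, hence to the pole `1/(a - it)` (`norm_trigSeries_coeffGap_le`,
`norm_geomKernel_sub_poleKernel_le`). By scaling, the `L_s` norm of the pole over the line is `(2
a^{1-s} I)^{1/s}` with `I = ∫_0^∞ (1 + x²)^{-s/2} dx`, and `I` is the hypergeometric value
(`hypergeometric_eq_poleIntegral`). The errors are of three kinds: bounded ones, the cut of the line
to one period (`fullPoleNorm_le_poleNorm_add`), and those of relative size `1/(n a) = 1/(α r n^r)`;
they give the three terms multiplied by `γ`. The threshold enters only through `n a ≥ 2` and `a ≤
1`. -/

noncomputable section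

namespace PoissonFourier

/-! ### Tail coefficients: comparison with geometric and power decay -/

/-- The normalized coefficients `exp (-α ((n + j)^r - n^r))` of the tail of the kernel. -/
def tailCoeff (α r : ℝ) (n j : ℕ) : ℝ :=
  exp (-(α * (((n : ℝ) + j) ^ r - (n : ℝ) ^ r)))

/-- The slope `α r n^{r-1}` of the exponent at `n`. -/
def slope (α r : ℝ) (n : ℕ) : ℝ := α * r * (n : ℝ) ^ (r - 1)

lemma tailCoeff_pos (α r : ℝ) (n j : ℕ) : 0 < tailCoeff α r n j := exp_pos _

lemma tailCoeff_zero (α r : ℝ) (n : ℕ) : tailCoeff α r n 0 = 1 := by simp [tailCoeff]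

lemma slope_pos {α r : ℝ} {n : ℕ} (hα : 0 < α) (hr : 0 < r) (hn : 1 ≤ n) : 0 < slope α r n := by
  have : (0 : ℝ) < n := by exact_mod_cast hn
  unfold slope; positivity

lemma rpow_add_one_sub_le {r x y : ℝ} (hr0 : 0 ≤ r) (hr1 : r ≤ 1) (hx : 0 < x) (hxy : x ≤ y) :
    (y + 1) ^ r - y ^ r ≤ r * x ^ (r - 1) := by
  have hy : 0 < y := hx.trans_le hxy
  have h1 : (1 + 1 / y) ^ r ≤ 1 + r * (1 / y) :=
    rpow_one_add_le_one_add_mul_self (by have := one_div_pos.2 hy; linarith) hr0 hr1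
  have h2 : (y + 1) ^ r = y ^ r * (1 + 1 / y) ^ r := by
    rw [← mul_rpow hy.le (by positivity)]; congr 1; field_simp
  have h3 : y ^ r * (1 / y) = y ^ (r - 1) := by rw [rpow_sub_one hy.ne']; ring
  have h4 : y ^ (r - 1) ≤ x ^ (r - 1) := rpow_le_rpow_of_nonpos hx hxy (by linarith)
  have h5 : y ^ r * (1 + 1 / y) ^ r ≤ y ^ r * (1 + r * (1 / y)) := by gcongr
  rw [h2]
  nlinarith [mul_le_mul_of_nonneg_left h4 hr0]

/-- By concavity of `x^r` the exponent grows by at most the slope at `n` in each step. This ratio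
bound gives the domination of `e^{-aj}` and later the control of the variation of the gap. -/
lemma exp_neg_slope_mul_tailCoeff_le {α r : ℝ} {n : ℕ} (hα : 0 < α) (hr0 : 0 < r) (hr1 : r < 1)
    (hn : 1 ≤ n) (j : ℕ) :
    exp (-slope α r n) * tailCoeff α r n j ≤ tailCoeff α r n (j + 1) := by
  have hn' : (0 : ℝ) < n := by exact_mod_cast hn
  have h := rpow_add_one_sub_le hr0.le hr1.le hn' (le_add_of_nonneg_right (Nat.cast_nonneg j))
  unfold tailCoeff slope
  rw [← exp_add, exp_le_exp]
  push_cast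
  rw [← add_assoc]
  nlinarith [mul_le_mul_of_nonneg_left h hα.le]

lemma exp_neg_slope_pow_le_tailCoeff {α r : ℝ} {n : ℕ} (hα : 0 < α) (hr0 : 0 < r) (hr1 : r < 1)
    (hn : 1 ≤ n) (j : ℕ) : exp (-slope α r n) ^ j ≤ tailCoeff α r n j := by
  induction j with
  | zero => simp [tailCoeff_zero]
  | succ j ih =>
    rw [pow_succ']
    exact (mul_le_mul_of_nonneg_left ih (exp_pos _).le).trans
      (exp_neg_slope_mul_tailCoeff_le hα hr0 hr1 hn j)

/-- From `e^u ≥ 1 + u` with `u = r log y` one gets `y^r - 1 ≥ r log y`, which trades the stretched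
exponential for a power that can be summed by telescoping. -/
lemma tailCoeff_le_rpow {α r : ℝ} {n : ℕ} (hα : 0 < α) (hn : 1 ≤ n) (j : ℕ) :
    tailCoeff α r n j ≤ (1 + (j : ℝ) / n) ^ (-(n * slope α r n)) := by
  have hn' : (0 : ℝ) < n := by exact_mod_cast hn
  have hy : 0 < 1 + (j : ℝ) / n := by positivity
  have h2 : ((n : ℝ) + j) ^ r = (n : ℝ) ^ r * (1 + (j : ℝ) / n) ^ r := by
    rw [← mul_rpow hn'.le hy.le]; congr 1; field_simp
  have h3 : (n : ℝ) * n ^ (r - 1) = n ^ r := by rw [rpow_sub_one hn'.ne']; field_simp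
  have h1 : r * log (1 + (j : ℝ) / n) ≤ (1 + (j : ℝ) / n) ^ r - 1 := by
    have := add_one_le_exp (log (1 + (j : ℝ) / n) * r)
    rw [← rpow_def_of_pos hy] at this
    linarith
  rw [rpow_def_of_pos hy, tailCoeff, exp_le_exp, h2]
  have h4 : (n : ℝ) * slope α r n = α * n ^ r * r := by rw [slope, ← h3]; ring
  rw [mul_neg, h4, neg_le_neg_iff]
  have h5 : 0 ≤ α * (n : ℝ) ^ r := by positivity
  nlinarith [mul_le_mul_of_nonneg_left h1 h5]

/-- A discrete integral test for `(1 + x/n)^{-k}`. Bernoulli's inequality is applied with exponent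
`k - 1`, which has to be at least `1`; this is the source of the condition `2 ≤ n a`. -/
lemma rpow_neg_le_sub {k n x : ℝ} (hk : 2 ≤ k) (hn : 0 < n) (hx : 0 ≤ x) :
    (1 + (x + 1) / n) ^ (-k) ≤
      n / (k - 1) * ((1 + x / n) ^ (1 - k) - (1 + (x + 1) / n) ^ (1 - k)) := by
  set y := 1 + (x + 1) / n with hy
  set z := 1 + x / n with hz
  have hz0 : 0 < z := by positivity
  have hy0 : 0 < y := by positivity
  have h1 : 1 + (k - 1) * (1 / (n * z)) ≤ (1 + 1 / (n * z)) ^ (k - 1) :=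
    one_add_mul_self_le_rpow_one_add (by have : 0 < 1 / (n * z) := by positivity
                                         linarith) (by linarith)
  have hyz : y = z * (1 + 1 / (n * z)) := by
    rw [hy, hz]; field_simp; ring
  have h2 : z ^ (1 - k) = y ^ (1 - k) * (1 + 1 / (n * z)) ^ (k - 1) := by
    rw [hyz, mul_rpow hz0.le (by positivity), mul_assoc, ← rpow_add (by positivity)]
    simp
  have h3 : y ^ (1 - k) = y * y ^ (-k) := by
    rw [sub_eq_add_neg, rpow_add hy0, rpow_one]
  have hzy : z ≤ y := by rw [hy, hz]; gcongr; linarith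
  have h4 : y ^ (-k) ≤ y ^ (1 - k) * (1 / z) := by
    rw [h3]
    have : 1 ≤ y / z := (one_le_div hz0).2 hzy
    have h5 : 0 < y ^ (-k) := by positivity
    calc y ^ (-k) ≤ y ^ (-k) * (y / z) := le_mul_of_one_le_right h5.le this
      _ = _ := by ring
  calc y ^ (-k) ≤ y ^ (1 - k) * (1 / z) := h4
    _ = n / (k - 1) * (y ^ (1 - k) * (1 + (k - 1) * (1 / (n * z))) - y ^ (1 - k)) := by
        have : k - 1 ≠ 0 := by linarith
        field_simp; ring
    _ ≤ n / (k - 1) * (y ^ (1 - k) * (1 + 1 / (n * z)) ^ (k - 1) - y ^ (1 - k)) := by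
        have : 0 ≤ n / (k - 1) := div_nonneg hn.le (by linarith)
        gcongr
    _ = _ := by rw [h2]

lemma sum_tailCoeff_le {α r : ℝ} {n : ℕ} (hα : 0 < α) (hn : 1 ≤ n)
    (hk : 2 ≤ n * slope α r n) (N : ℕ) :
    ∑ j ∈ Finset.range N, tailCoeff α r n j ≤ 1 + n / (n * slope α r n - 1) := by
  set k := n * slope α r n with hkd
  have hn' : (0 : ℝ) < n := by exact_mod_cast hn
  have hc : 0 ≤ (n : ℝ) / (k - 1) := div_nonneg hn'.le (by linarith)
  -- The telescoping remainder is kept in the induction hypothesis and dropped only at the end.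
  have key : ∀ N : ℕ, ∑ j ∈ Finset.range (N + 1), tailCoeff α r n j ≤
      1 + n / (k - 1) * (1 - (1 + (N : ℝ) / n) ^ (1 - k)) := by
    intro N
    induction N with
    | zero => simp [tailCoeff_zero]
    | succ N ih =>
      rw [Finset.sum_range_succ]
      have h1 := tailCoeff_le_rpow (r := r) hα hn (N + 1)
      have h2 := rpow_neg_le_sub hk hn' (Nat.cast_nonneg N)
      push_cast at h1 ⊢
      rw [← hkd] at h1
      linarith
  have hm : ∑ j ∈ Finset.range N, tailCoeff α r n j ≤
      ∑ j ∈ Finset.range (N + 1), tailCoeff α r n j :=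
    Finset.sum_le_sum_of_subset_of_nonneg (Finset.range_mono (Nat.le_succ N))
      fun _ _ _ => (tailCoeff_pos ..).le
  have h0 : 0 ≤ (1 + (N : ℝ) / n) ^ (1 - k) := by positivity
  nlinarith [key N, mul_nonneg hc h0]

lemma summable_tailCoeff {α r : ℝ} {n : ℕ} (hα : 0 < α) (hn : 1 ≤ n)
    (hk : 2 ≤ n * slope α r n) : Summable (tailCoeff α r n) :=
  summable_of_sum_range_le (fun _ => (tailCoeff_pos ..).le) (sum_tailCoeff_le hα hn hk)

lemma tsum_tailCoeff_le {α r : ℝ} {n : ℕ} (hα : 0 < α) (hn : 1 ≤ n)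
    (hk : 2 ≤ n * slope α r n) :
    ∑' j, tailCoeff α r n j ≤ 1 + n / (n * slope α r n - 1) :=
  (summable_tailCoeff hα hn hk).tsum_le_of_sum_range_le (sum_tailCoeff_le hα hn hk)

/-! ### The gap to the geometric progression: sum and total variation -/

/-- The difference between the tail coefficients and the geometric ones. -/
def coeffGap (α r : ℝ) (n j : ℕ) : ℝ := tailCoeff α r n j - exp (-slope α r n) ^ j

section Gap

variable {α r : ℝ} {n : ℕ}

lemma coeffGap_zero : coeffGap α r n 0 = 0 := by simp [coeffGap, tailCoeff_zero]

lemma coeffGap_nonneg (hα : 0 < α) (hr0 : 0 < r) (hr1 : r < 1) (hn : 1 ≤ n) (j : ℕ) :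
    0 ≤ coeffGap α r n j :=
  sub_nonneg.2 (exp_neg_slope_pow_le_tailCoeff hα hr0 hr1 hn j)

lemma summable_exp_neg_pow {a : ℝ} (ha : 0 < a) : Summable fun j : ℕ => exp (-a) ^ j :=
  summable_geometric_of_lt_one (exp_pos _).le (by simpa using ha)

lemma summable_coeffGap (hα : 0 < α) (hr0 : 0 < r) (hn : 1 ≤ n)
    (hk : 2 ≤ n * slope α r n) : Summable (coeffGap α r n) :=
  (summable_tailCoeff hα hn hk).sub (summable_exp_neg_pow (slope_pos hα hr0 hn))

lemma one_sub_exp_neg_le (a : ℝ) : 1 - exp (-a) ≤ a := by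
  have := add_one_le_exp (-a); linarith

lemma half_le_one_sub_exp_neg {a : ℝ} (ha : 0 < a) (ha1 : a ≤ 1) : a / 2 ≤ 1 - exp (-a) := by
  have h : exp (-a) ≤ 1 / (1 + a) := by
    rw [exp_neg, ← one_div]
    exact one_div_le_one_div_of_le (by linarith) (by linarith [add_one_le_exp a])
  have h2 : 1 / (1 + a) ≤ 1 - a / 2 := by
    rw [div_le_iff₀ (by linarith)]; nlinarith
  linarith

/-- The leading parts cancel: `n/(na - 1)` exceeds `1/a` by at most `2/(n a²)`, while the geometric
sum is at least `1/a`. -/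
lemma tsum_coeffGap_le (hα : 0 < α) (hr0 : 0 < r) (hn : 1 ≤ n)
    (hk : 2 ≤ n * slope α r n) :
    ∑' j, coeffGap α r n j ≤ 1 + 2 / (n * slope α r n ^ 2) := by
  have ha := slope_pos hα hr0 hn
  have hn' : (0 : ℝ) < n := by exact_mod_cast hn
  have h1 := tsum_tailCoeff_le hα hn hk
  have h2 : ∑' j, coeffGap α r n j = ∑' j, tailCoeff α r n j - (1 - exp (-slope α r n))⁻¹ := by
    unfold coeffGap
    rw [(summable_tailCoeff hα hn hk).tsum_sub (summable_exp_neg_pow ha),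
      tsum_geometric_of_lt_one (exp_pos _).le (by simpa using ha)]
  set a := slope α r n
  have h3 : a⁻¹ ≤ (1 - exp (-a))⁻¹ :=
    inv_anti₀ (sub_pos.2 (by simpa using ha)) (one_sub_exp_neg_le a)
  have h4 : n / (n * a - 1) ≤ a⁻¹ + 2 / (n * a ^ 2) := by
    rw [div_le_iff₀ (by linarith)]
    have : (a⁻¹ + 2 / (n * a ^ 2)) * (n * a - 1) = n + (n * a - 2) / (n * a ^ 2) := by
      field_simp; ring
    rw [this]
    have : 0 ≤ (n * a - 2) / (n * a ^ 2) := div_nonneg (by linarith) (by positivity)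
    linarith
  linarith

/-- The gap `d` satisfies `d_{j+1} ≥ e^{-a} d_j`, so a step down is at most `(1 - e^{-a}) d_j`, and
`|x| = x + 2 x⁻`. The terms `x` telescope to zero, so the total variation is bounded without knowing
where `d` is monotone. -/
lemma abs_coeffGap_succ_sub_le (hα : 0 < α) (hr0 : 0 < r) (hr1 : r < 1) (hn : 1 ≤ n) (j : ℕ) :
    |coeffGap α r n (j + 1) - coeffGap α r n j| ≤
      coeffGap α r n (j + 1) - coeffGap α r n j +
        2 * ((1 - exp (-slope α r n)) * coeffGap α r n j) := by
  have h1 := exp_neg_slope_mul_tailCoeff_le hα hr0 hr1 hn j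
  have h2 := coeffGap_nonneg hα hr0 hr1 hn j
  have h3 : exp (-slope α r n) ≤ 1 := exp_le_one_iff.2 (by linarith [slope_pos hα hr0 hn])
  have h4 := mul_nonneg (sub_nonneg.2 h3) h2
  rw [abs_le]
  refine ⟨?_, by linarith⟩
  have : coeffGap α r n (j + 1) = tailCoeff α r n (j + 1)
    - exp (-slope α r n) * exp (-slope α r n) ^ j := by rw [coeffGap, pow_succ']
  rw [this] at *
  unfold coeffGap at *
  linarith

lemma hasSum_coeffGap_succ_sub (hα : 0 < α) (hr0 : 0 < r) (hn : 1 ≤ n)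
    (hk : 2 ≤ n * slope α r n) :
    HasSum (fun j => coeffGap α r n (j + 1) - coeffGap α r n j) 0 := by
  have hs := summable_coeffGap hα hr0 hn hk
  have h1 := ((summable_nat_add_iff 1).2 hs).hasSum.sub hs.hasSum
  have h2 := hs.sum_add_tsum_nat_add 1
  simp only [Finset.sum_range_one, coeffGap_zero, zero_add] at h2
  rwa [h2, sub_self] at h1

lemma tsum_abs_coeffGap_succ_sub_le (hα : 0 < α) (hr0 : 0 < r) (hr1 : r < 1) (hn : 1 ≤ n)
    (hk : 2 ≤ n * slope α r n) :
    Summable (fun j => |coeffGap α r n (j + 1) - coeffGap α r n j|) ∧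
    ∑' j, |coeffGap α r n (j + 1) - coeffGap α r n j| ≤
      2 * ((1 - exp (-slope α r n)) * ∑' j, coeffGap α r n j) := by
  have hs := summable_coeffGap hα hr0 hn hk
  have h := (hasSum_coeffGap_succ_sub hα hr0 hn hk).add
    ((hs.hasSum.mul_left (1 - exp (-slope α r n))).mul_left 2)
  have hS := Summable.of_nonneg_of_le (fun _ => abs_nonneg _)
    (abs_coeffGap_succ_sub_le hα hr0 hr1 hn) h.summable
  refine ⟨hS, ?_⟩
  have := hasSum_le (abs_coeffGap_succ_sub_le hα hr0 hr1 hn) hS.hasSum h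
  linarith

end Gap

/-! ### Trigonometric series and summation by parts -/

/-- The series `∑ c_j e^{i j t}`. -/
def trigSeries (c : ℕ → ℝ) (t : ℝ) : ℂ := ∑' j, (c j : ℂ) * Complex.exp (t * Complex.I) ^ j

lemma norm_trigSeries_term (c : ℕ → ℝ) (t : ℝ) (j : ℕ) :
    ‖(c j : ℂ) * Complex.exp (t * Complex.I) ^ j‖ = |c j| := by
  simp [Complex.norm_exp_ofReal_mul_I]

lemma summable_trigSeries {c : ℕ → ℝ} (hc : Summable c) (t : ℝ) :
    Summable fun j => (c j : ℂ) * Complex.exp (t * Complex.I) ^ j :=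
  .of_norm (by simpa only [norm_trigSeries_term] using hc.abs)

lemma continuous_trigSeries {c : ℕ → ℝ} (hc : Summable c) : Continuous (trigSeries c) :=
  continuous_tsum (fun j => by fun_prop) hc.abs fun j t => (norm_trigSeries_term c t j).le

lemma periodic_trigSeries (c : ℕ → ℝ) : Function.Periodic (trigSeries c) (2 * π) := by
  intro t
  simp only [trigSeries]
  congr! 3
  push_cast
  rw [add_mul, Complex.exp_add, Complex.exp_two_pi_mul_I, mul_one]

lemma norm_trigSeries_le {c : ℕ → ℝ} (hc : Summable c) (h0 : ∀ j, 0 ≤ c j) (t : ℝ) :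
    ‖trigSeries c t‖ ≤ ∑' j, c j := by
  refine tsum_of_norm_bounded hc.hasSum fun j => ?_
  rw [norm_trigSeries_term, abs_of_nonneg (h0 j)]

lemma trigSeries_sub {c d : ℕ → ℝ} (hc : Summable c) (hd : Summable d) (t : ℝ) :
    trigSeries (fun j => c j - d j) t = trigSeries c t - trigSeries d t := by
  unfold trigSeries
  rw [← (summable_trigSeries hc t).tsum_sub (summable_trigSeries hd t)]
  congr! 2 with j
  push_cast; ring

/-- Summation by parts; the vanishing of `c 0` removes the boundary term. -/
lemma one_sub_mul_trigSeries {c : ℕ → ℝ} (hc : Summable c) (h0 : c 0 = 0) (t : ℝ) :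
    (1 - Complex.exp (t * Complex.I)) * trigSeries c t =
      ∑' j, ((c (j + 1) - c j : ℝ) : ℂ) * Complex.exp (t * Complex.I) ^ (j + 1) := by
  have hs := summable_trigSeries hc t
  have h1 := hs.sum_add_tsum_nat_add 1
  simp only [Finset.sum_range_one, h0, Complex.ofReal_zero, zero_mul, zero_add] at h1
  have hs1 := (summable_nat_add_iff 1).2 hs
  have h2 : Complex.exp (t * Complex.I) * trigSeries c t =
      ∑' j, (c j : ℂ) * Complex.exp (t * Complex.I) ^ (j + 1) := by
    unfold trigSeries
    rw [← tsum_mul_left]; congr! 2 with j; ring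
  have hs2 : Summable fun j => (c j : ℂ) * Complex.exp (t * Complex.I) ^ (j + 1) := by
    refine (hs.mul_left (Complex.exp (t * Complex.I))).congr fun j => ?_
    ring
  rw [sub_mul, one_mul, h2]
  unfold trigSeries
  rw [← h1, ← hs1.tsum_sub hs2]
  congr! 2 with j
  push_cast; ring

lemma two_div_pi_mul_abs_le_norm_one_sub_exp {t : ℝ} (ht : |t| ≤ π) :
    2 / π * |t| ≤ ‖1 - Complex.exp (t * Complex.I)‖ := by
  rw [norm_sub_rev, mul_comm (t : ℂ), Complex.norm_exp_I_mul_ofReal_sub_one, norm_eq_abs, abs_mul,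
    abs_two]
  have := mul_abs_le_abs_sin (x := t / 2) (by rw [abs_div, abs_two]; linarith)
  rw [abs_div, abs_two] at this
  linarith

/-! ### The pole and geometric kernels -/

/-- The model `(a - i t)⁻¹` of the kernel on the line. -/
def poleKernel (a t : ℝ) : ℂ := ((a : ℂ) - t * Complex.I)⁻¹

/-- The periodic model `(1 - e^{-a + i t})⁻¹` of the kernel. -/
def geomKernel (a t : ℝ) : ℂ := (1 - exp (-a) * Complex.exp (t * Complex.I))⁻¹

lemma trigSeries_exp_neg_pow {a : ℝ} (ha : 0 < a) (t : ℝ) :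
    trigSeries (fun j => exp (-a) ^ j) t = geomKernel a t := by
  unfold trigSeries geomKernel
  rw [← tsum_geometric_of_norm_lt_one]
  · congr! 2 with j; rw [mul_pow]; push_cast; rfl
  · rw [norm_mul, Complex.norm_exp_ofReal_mul_I, mul_one, Complex.norm_real, norm_eq_abs, abs_exp]
    simpa using ha

lemma norm_denom_le (a t : ℝ) (ha : 0 < a) : ‖(a : ℂ) - t * Complex.I‖ ≤ a + |t| := by
  refine (norm_sub_le _ _).trans ?_
  simp [abs_of_pos ha]

lemma denom_ne_zero {a : ℝ} (t : ℝ) (ha : 0 < a) : (a : ℂ) - t * Complex.I ≠ 0 := by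
  intro h
  have := congrArg Complex.re h
  simp at this
  exact ha.ne' this

lemma continuous_poleKernel {a : ℝ} (ha : 0 < a) : Continuous (poleKernel a) := by
  unfold poleKernel
  exact Continuous.inv₀ (by fun_prop) fun t => denom_ne_zero t ha

lemma le_norm_one_sub_exp_neg_mul {a : ℝ} (ha : 0 < a) (ha1 : a ≤ 1) (t : ℝ) :
    a / 2 ≤ ‖1 - exp (-a) * Complex.exp (t * Complex.I)‖ := by
  have h1 : ‖(1 : ℂ)‖ - ‖(exp (-a) : ℂ) * Complex.exp (t * Complex.I)‖ ≤
    ‖1 - exp (-a) * Complex.exp (t * Complex.I)‖ := norm_sub_norm_le _ _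
  rw [norm_mul, Complex.norm_exp_ofReal_mul_I, mul_one, norm_one, Complex.norm_real, norm_eq_abs,
    abs_exp] at h1
  linarith [half_le_one_sub_exp_neg ha ha1]

/-- With `X` the norm on the right, `a ≤ 2X`, and `|1 - e^{it}| ≤ X + (1 - e^{-a}) ≤ 2X` gives `|t|
≤ πX`. The sum `2 + π` is at most `2π`. -/
lemma norm_denom_le_mul {a t : ℝ} (ha : 0 < a) (ha1 : a ≤ 1) (ht : |t| ≤ π) :
    ‖(a : ℂ) - t * Complex.I‖ ≤ 2 * π * ‖1 - exp (-a) * Complex.exp (t * Complex.I)‖ := by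
  have h1 := le_norm_one_sub_exp_neg_mul ha ha1 t
  have h2 := two_div_pi_mul_abs_le_norm_one_sub_exp ht
  set X := ‖1 - exp (-a) * Complex.exp (t * Complex.I)‖ with hX
  have h3 : ‖1 - Complex.exp (t * Complex.I)‖ ≤ X + (1 - exp (-a)) := by
    have : (1 : ℂ) - Complex.exp (t * Complex.I) =
      (1 - exp (-a) * Complex.exp (t * Complex.I)) -
        ((1 - exp (-a) : ℝ) : ℂ) * Complex.exp (t * Complex.I) := by push_cast; ring
    rw [this]
    refine (norm_sub_le _ _).trans ?_
    rw [norm_mul, Complex.norm_exp_ofReal_mul_I, mul_one, Complex.norm_real, norm_eq_abs,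
      abs_of_nonneg (by linarith [half_le_one_sub_exp_neg ha ha1])]
  have h4 : 1 - exp (-a) ≤ X := by
    have h1 : ‖(1 : ℂ)‖ - ‖(exp (-a) : ℂ) * Complex.exp (t * Complex.I)‖ ≤ X :=
      norm_sub_norm_le _ _
    rwa [norm_mul, Complex.norm_exp_ofReal_mul_I, mul_one, norm_one, Complex.norm_real,
      norm_eq_abs, abs_exp] at h1
  have h5 : |t| ≤ π * X := by
    have : 2 / π * |t| ≤ 2 * X := by linarith
    rw [div_mul_eq_mul_div, div_le_iff₀ pi_pos] at this
    linarith
  have := norm_denom_le a t ha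
  nlinarith [pi_gt_three, norm_nonneg (1 - exp (-a) * Complex.exp (t * Complex.I))]

lemma norm_geomKernel_le {a t : ℝ} (ha : 0 < a) (ha1 : a ≤ 1) (ht : |t| ≤ π) :
    ‖geomKernel a t‖ ≤ 2 * π * ‖poleKernel a t‖ := by
  unfold geomKernel poleKernel
  rw [norm_inv, norm_inv]
  have h1 := le_norm_one_sub_exp_neg_mul ha ha1 t
  have h2 : 0 < ‖(a : ℂ) - t * Complex.I‖ := norm_pos_iff.2 (denom_ne_zero t ha)
  have h3 := norm_denom_le_mul ha ha1 ht
  rw [← div_eq_mul_inv, le_div_iff₀ h2, inv_mul_le_iff₀ (by linarith)]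
  linarith

/-- For large `z` the sign of the real part gives `|e^z| ≤ 1`, and then `2 + |z| ≤ 3|z|²`. -/
lemma norm_exp_sub_one_sub_le {z : ℂ} (hz : z.re ≤ 0) : ‖Complex.exp z - 1 - z‖ ≤ 3 * ‖z‖ ^ 2 := by
  rcases le_total ‖z‖ 1 with h | h
  · have := Complex.norm_exp_sub_one_sub_id_le h
    nlinarith [norm_nonneg z]
  · have h1 : ‖Complex.exp z‖ ≤ 1 := by rw [Complex.norm_exp]; simpa using hz
    have h2 := norm_sub_le (Complex.exp z - 1) z
    have h3 := norm_sub_le (Complex.exp z) 1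
    rw [norm_one] at h3
    nlinarith

/-- With `z = -(a - it)` the difference has numerator `e^z - 1 - z`, of size at most `3|z|²`, and a
denominator of size at least `|z|²/(2π)`. The double zero cancels the two poles, so the bound does
not depend on `a`. -/
lemma norm_geomKernel_sub_poleKernel_le {a t : ℝ} (ha : 0 < a) (ha1 : a ≤ 1) (ht : |t| ≤ π) :
    ‖geomKernel a t - poleKernel a t‖ ≤ 6 * π := by
  have h1 := le_norm_one_sub_exp_neg_mul ha ha1 t
  have h2 : 0 < ‖(a : ℂ) - t * Complex.I‖ := norm_pos_iff.2 (denom_ne_zero t ha)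
  have h3 := norm_denom_le_mul ha ha1 ht
  have hx : (1 : ℂ) - exp (-a) * Complex.exp (t * Complex.I) ≠ 0 :=
    norm_pos_iff.1 (by linarith)
  unfold geomKernel poleKernel
  rw [inv_sub_inv hx (denom_ne_zero t ha), norm_div, norm_mul, div_le_iff₀ (by positivity)]
  have h4 := norm_exp_sub_one_sub_le (z := -(a - t * Complex.I)) (by simp [ha.le])
  have h5 : (a : ℂ) - t * Complex.I - (1 - exp (-a) * Complex.exp (t * Complex.I)) =
      Complex.exp (-(a - t * Complex.I)) - 1 - -(a - t * Complex.I) := by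
    have : -((a : ℂ) - t * Complex.I) = ((-a : ℝ) : ℂ) + t * Complex.I := by push_cast; ring
    rw [this, Complex.exp_add, Complex.ofReal_exp]; push_cast; ring
  rw [h5]
  rw [norm_neg] at h4
  refine h4.trans ?_
  nlinarith [mul_le_mul_of_nonneg_left h3 h2.le]

/-- Only one of the two denominators is bounded below by `a/2`; the other is kept as the kernel
itself, so that a shift of order `1/n` costs a relative error of order `1/(na)`. -/
lemma norm_geomKernel_add_sub_le {a : ℝ} (ha : 0 < a) (ha1 : a ≤ 1) (t h : ℝ) :
    ‖geomKernel a (t + h) - geomKernel a t‖ ≤ |h| * (2 / a) * ‖geomKernel a t‖ := by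
  have h1 := le_norm_one_sub_exp_neg_mul ha ha1 t
  have h2 := le_norm_one_sub_exp_neg_mul ha ha1 (t + h)
  have hx : (1 : ℂ) - exp (-a) * Complex.exp (t * Complex.I) ≠ 0 :=
    norm_pos_iff.1 (by linarith)
  have hy : (1 : ℂ) - exp (-a) * Complex.exp ((t + h : ℝ) * Complex.I) ≠ 0 :=
    norm_pos_iff.1 (by linarith)
  unfold geomKernel
  rw [inv_sub_inv hy hx]
  have h5 : (1 : ℂ) - exp (-a) * Complex.exp (t * Complex.I) -
      (1 - exp (-a) * Complex.exp ((t + h : ℝ) * Complex.I)) =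
      exp (-a) * Complex.exp (t * Complex.I) * (Complex.exp (Complex.I * h) - 1) := by
    have : ((t + h : ℝ) : ℂ) * Complex.I = t * Complex.I + Complex.I * h := by push_cast; ring
    rw [this, Complex.exp_add]; ring
  rw [h5, norm_div, norm_mul, norm_mul, norm_mul, Complex.norm_exp_ofReal_mul_I, mul_one,
    Complex.norm_real, norm_eq_abs, abs_exp, norm_inv]
  have h6 : ‖Complex.exp (Complex.I * h) - 1‖ ≤ |h| := norm_exp_I_mul_ofReal_sub_one_le
  have h7 : exp (-a) ≤ 1 := exp_le_one_iff.2 (by linarith)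
  have h8 : exp (-a) * ‖Complex.exp (Complex.I * h) - 1‖ ≤ 1 * |h| := by gcongr
  have h9 : ‖1 - exp (-a) * Complex.exp ((t + h : ℝ) * Complex.I)‖⁻¹ ≤ 2 / a := by
    rw [← inv_div]; exact inv_anti₀ (by linarith) h2
  calc _ = (exp (-a) * ‖Complex.exp (Complex.I * h) - 1‖) *
        ‖1 - exp (-a) * Complex.exp ((t + h : ℝ) * Complex.I)‖⁻¹ *
        ‖1 - exp (-a) * Complex.exp (t * Complex.I)‖⁻¹ := by
          rw [div_eq_mul_inv, mul_inv]; ring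
    _ ≤ _ := by
      rw [one_mul] at h8
      gcongr

/-- Let `T` be the sum of the gap and `D` the norm to be bounded. The trivial bound `D ≤ T` handles
small `t`; summation by parts gives `|t| D ≤ π a T`. Together `D |a - it| ≤ (1 + π) a T ≤ 5 a T`,
and `a T ≤ a + 2/(na)`. -/
lemma norm_trigSeries_coeffGap_le {α r : ℝ} {n : ℕ} (hα : 0 < α) (hr0 : 0 < r) (hr1 : r < 1)
    (hn : 1 ≤ n) (hk : 2 ≤ n * slope α r n) {t : ℝ} (ht : |t| ≤ π) :
    ‖trigSeries (coeffGap α r n) t‖ ≤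
      5 + 10 / (n * slope α r n) * ‖poleKernel (slope α r n) t‖ := by
  have ha := slope_pos hα hr0 hn
  have hn' : (0 : ℝ) < n := by exact_mod_cast hn
  have hs := summable_coeffGap hα hr0 hn hk
  have hσ := tsum_coeffGap_le hα hr0 hn hk
  have h0 := coeffGap_nonneg hα hr0 hr1 hn
  have h1 := norm_trigSeries_le hs h0 t
  obtain ⟨hS, hS'⟩ := tsum_abs_coeffGap_succ_sub_le hα hr0 hr1 hn hk
  have h2 : ‖1 - Complex.exp (t * Complex.I)‖ * ‖trigSeries (coeffGap α r n) t‖ ≤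
      2 * ((1 - exp (-slope α r n)) * ∑' j, coeffGap α r n j) := by
    rw [← norm_mul, one_sub_mul_trigSeries hs coeffGap_zero]
    refine (tsum_of_norm_bounded hS.hasSum fun j => ?_).trans hS'
    -- The truncated predecessor `i - 1` is evaluated only at `i = j + 1`.
    exact (norm_trigSeries_term (fun i => coeffGap α r n i - coeffGap α r n (i - 1)) t (j + 1)).le
  have h3 := two_div_pi_mul_abs_le_norm_one_sub_exp ht
  have h4 := one_sub_exp_neg_le (slope α r n)
  have h5 := norm_denom_le (slope α r n) t ha
  have hT : 0 ≤ ∑' j, coeffGap α r n j := tsum_nonneg h0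
  have h6 : 0 < ‖(slope α r n : ℂ) - t * Complex.I‖ := norm_pos_iff.2 (denom_ne_zero t ha)
  have h7 : slope α r n ≤ ‖(slope α r n : ℂ) - t * Complex.I‖ := by
    simpa using Complex.re_le_norm ((slope α r n : ℂ) - t * Complex.I)
  unfold poleKernel
  rw [norm_inv]
  set D := ‖trigSeries (coeffGap α r n) t‖
  set T := ∑' j, coeffGap α r n j
  set a := slope α r n
  set Z := ‖(a : ℂ) - t * Complex.I‖
  have hD : 0 ≤ D := norm_nonneg _
  have h8 : |t| * D ≤ π * (a * T) := by
    have e1 : 2 / π * |t| * D ≤ 2 * (a * T) := by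
      calc _ ≤ _ := mul_le_mul_of_nonneg_right h3 hD
        _ ≤ _ := h2
        _ ≤ _ := by gcongr
    have e2 : 2 / π * |t| * D = 2 * (|t| * D) / π := by ring
    rw [e2, div_le_iff₀ pi_pos] at e1
    linarith
  have h9 : D * Z ≤ 5 * (a * T) := by
    have e1 : D * Z ≤ D * (a + |t|) := by gcongr
    have e2 : D * a ≤ T * a := by gcongr
    have e3 : 0 ≤ a * T := by positivity
    nlinarith [pi_lt_four]
  have h10 : a * T ≤ Z + 2 / (n * a) := by
    have : a * T ≤ a * (1 + 2 / (n * a ^ 2)) := by gcongr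
    have e : a * (1 + 2 / (n * a ^ 2)) = a + 2 / (n * a) := by field_simp
    linarith
  have h11 : D ≤ 5 * (Z + 2 / (n * a)) / Z := by
    rw [le_div_iff₀ h6]; linarith
  refine h11.trans (le_of_eq ?_)
  field_simp
  ring

/-! ### The hypergeometric value at 1 as an integral -/

/-- The coefficients `(b)_k / k!` of the binomial series of `(1 - x)^{-b}`. -/
def risingCoeff (b : ℝ) (k : ℕ) : ℝ := (k.factorial : ℝ)⁻¹ * (ascPochhammer ℝ k).eval b

lemma risingCoeff_succ (b : ℝ) (k : ℕ) :
    risingCoeff b (k + 1) = risingCoeff b k * ((b + k) / (k + 1)) := by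
  unfold risingCoeff
  rw [ascPochhammer_succ_eval, Nat.factorial_succ]
  have : (k.factorial : ℝ) ≠ 0 := by positivity
  have : (k : ℝ) + 1 ≠ 0 := by positivity
  push_cast
  field_simp

lemma risingCoeff_eq_choose (b : ℝ) (k : ℕ) : risingCoeff b k = Ring.choose (b + k - 1) k := by
  rw [← Ring.multichoose_eq, risingCoeff, ← Polynomial.ascPochhammer_smeval_eq_eval,
    ← Ring.factorial_nsmul_multichoose_eq_ascPochhammer, nsmul_eq_mul, inv_mul_cancel_left₀]
  positivity

lemma hasSum_risingCoeff (b : ℝ) {x : ℝ} (hx : |x| < 1) :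
    HasSum (fun k => risingCoeff b k * x ^ k) ((1 - x) ^ (-b)) := by
  have h := (Real.one_div_one_sub_rpow_hasFPowerSeriesOnBall_zero b).hasSum (y := x)
    (by simpa [Metric.mem_eball, edist_dist, ENNReal.ofReal_lt_one] using hx)
  simp only [FormalMultilinearSeries.ofScalars_apply_eq, zero_add, smul_eq_mul] at h
  have hx1 : 0 ≤ 1 - x := by have := (abs_lt.1 hx).2; linarith
  rw [rpow_neg hx1, ← one_div]
  simpa only [risingCoeff_eq_choose] using h

/-- Once `b + k ≥ 0`, the recursion for `v k = |risingCoeff b k|` reads `v k - v (k+1) = (1 - b) v k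
/ (k + 1)`, so the series telescopes. This justifies termwise integration below. -/
lemma summable_abs_risingCoeff_div {b : ℝ} (hb : b < 1) :
    Summable fun k : ℕ => |risingCoeff b k| / (2 * k + 1) := by
  obtain ⟨N, hN⟩ := exists_nat_ge (-b)
  have hN0 : ∀ k : ℕ, 0 ≤ b + (k + N : ℕ) := fun k => by
    push_cast; have : (0 : ℝ) ≤ k := k.cast_nonneg; linarith
  set v : ℕ → ℝ := fun k => |risingCoeff b k| with hv
  have hrec : ∀ k, v (k + N + 1) = v (k + N) * ((b + (k + N : ℕ)) / ((k + N : ℕ) + 1)) := by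
    intro k
    simp only [hv]
    rw [risingCoeff_succ, abs_mul, abs_div, abs_of_nonneg (hN0 k),
      abs_of_nonneg (by positivity : (0 : ℝ) ≤ (k + N : ℕ) + 1)]
  have hstep : ∀ k, v (k + N) / ((k + N : ℕ) + 1) = (v (k + N) - v (k + 1 + N)) / (1 - b) := by
    intro k
    have h1 : (1 - b) ≠ 0 := by linarith
    have h2 : ((k + N : ℕ) : ℝ) + 1 ≠ 0 := by positivity
    rw [show k + 1 + N = k + N + 1 by ring, hrec]
    field_simp; ring
  rw [← summable_nat_add_iff N]
  have hS : Summable fun k => v (k + N) / ((k + N : ℕ) + 1) := by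
    refine summable_of_sum_range_le (c := v N / (1 - b)) (fun k => by positivity) fun n => ?_
    simp_rw [hstep]
    rw [← Finset.sum_div, Finset.sum_range_sub' (fun k => v (k + N)), zero_add]
    have : 0 ≤ v (n + N) := abs_nonneg _
    have : 0 < 1 - b := by linarith
    gcongr
    linarith
  refine hS.of_nonneg_of_le (fun k => by positivity) fun k => ?_
  have : (0 : ℝ) ≤ (k + N : ℕ) := Nat.cast_nonneg _
  have : 0 ≤ v (k + N) := abs_nonneg _
  change v (k + N) / _ ≤ _
  gcongr
  linarith

lemma ascPochhammer_half_div (k : ℕ) :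
    (ascPochhammer ℝ k).eval (1 / 2 : ℝ) * ((ascPochhammer ℝ k).eval (3 / 2 : ℝ))⁻¹ =
      1 / (2 * k + 1) := by
  have h : (ascPochhammer ℝ k).eval (1 / 2 : ℝ) * (2 * k + 1) =
      (ascPochhammer ℝ k).eval (3 / 2 : ℝ) := by
    induction k with
    | zero => simp
    | succ k ih =>
      rw [ascPochhammer_succ_eval, ascPochhammer_succ_eval, ← ih]; push_cast; ring
  have h0 : 0 < (ascPochhammer ℝ k).eval (1 / 2 : ℝ) := ascPochhammer_pos k _ (by norm_num)
  rw [← h]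
  field_simp

/-- Since `(1/2)_k / (3/2)_k = 1/(2k+1) = ∫_0^1 t^{2k} dt`, the series is the termwise integral of
the binomial series of `(1 - t²)^{-b}`. -/
lemma hypergeometric_eq_integral {b : ℝ} (hb : b < 1) :
    ordinaryHypergeometric (1 / 2 : ℝ) b (3 / 2) (1 : ℝ) = ∫ t in Ioo (0 : ℝ) 1, (1 - t ^ 2) ^ (-b) := by
  have hint : ∀ k : ℕ, ∫ t in Ioo (0 : ℝ) 1, t ^ (2 * k) = 1 / (2 * k + 1) := by
    intro k
    rw [← integral_Ioc_eq_integral_Ioo, ← intervalIntegral.integral_of_le zero_le_one,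
      integral_pow]
    simp
  have hi : ∀ k : ℕ, IntegrableOn (fun t : ℝ => t ^ (2 * k)) (Ioo 0 1) := fun k =>
    ((continuous_pow (2 * k)).integrableOn_Icc (a := 0) (b := 1)).mono_set Ioo_subset_Icc_self
  have h := hasSum_integral_of_summable_integral_norm
    (μ := volume.restrict (Ioo (0 : ℝ) 1)) (F := fun k t => risingCoeff b k * t ^ (2 * k))
    (fun k => (hi k).const_mul _) (by
      refine (summable_abs_risingCoeff_div hb).congr fun k => ?_
      have : ∀ t : ℝ, ‖risingCoeff b k * t ^ (2 * k)‖ = |risingCoeff b k| * t ^ (2 * k) := by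
        intro t
        rw [norm_mul, norm_eq_abs, norm_eq_abs, abs_of_nonneg ((even_two_mul k).pow_nonneg t)]
      simp_rw [this]
      rw [integral_const_mul, hint]; ring)
  have e1 : ∫ t in Ioo (0 : ℝ) 1, (1 - t ^ 2) ^ (-b) =
      ∫ t in Ioo (0 : ℝ) 1, ∑' k, risingCoeff b k * t ^ (2 * k) := by
    refine setIntegral_congr_fun measurableSet_Ioo fun t ht => ?_
    have ht2 : |t ^ 2| < 1 := by
      rw [abs_of_nonneg (sq_nonneg t)]; exact pow_lt_one₀ ht.1.le ht.2 two_ne_zero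
    rw [← (hasSum_risingCoeff b ht2).tsum_eq]
    simp_rw [pow_mul]
  rw [e1, ← h.tsum_eq, ordinaryHypergeometric_eq_tsum]
  refine tsum_congr fun k => ?_
  rw [integral_const_mul, hint, ← ascPochhammer_half_div k, risingCoeff]
  simp only [one_pow, smul_eq_mul, mul_one]
  ring

/-! ### The pole integral and its hypergeometric form -/

/-- The integral `∫_0^∞ (1 + x²)^{-s/2} dx`. -/
def poleIntegral (s : ℝ) : ℝ := ∫ x in Ioi (0 : ℝ), (1 + x ^ 2) ^ (-(s / 2))

lemma one_add_sq_pos (x : ℝ) : 0 < 1 + x ^ 2 := by positivity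

lemma continuous_one_add_sq_rpow (s : ℝ) : Continuous fun x : ℝ => (1 + x ^ 2) ^ (-(s / 2)) :=
  Continuous.rpow_const (by fun_prop) fun x => Or.inl (one_add_sq_pos x).ne'

lemma one_add_sq_rpow_le {s x : ℝ} (hs : 0 ≤ s) (hx : 0 < x) :
    (1 + x ^ 2) ^ (-(s / 2)) ≤ x ^ (-s) := by
  calc (1 + x ^ 2) ^ (-(s / 2)) ≤ (x ^ 2) ^ (-(s / 2)) :=
        rpow_le_rpow_of_nonpos (by positivity) (by linarith) (by linarith)
    _ = x ^ (-s) := by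
        rw [← rpow_natCast, ← rpow_mul hx.le]; congr 1; push_cast; ring

lemma integrableOn_one_add_sq_Ioi {s : ℝ} (hs : 1 < s) (c : ℝ) :
    IntegrableOn (fun x : ℝ => (1 + x ^ 2) ^ (-(s / 2))) (Ioi c) := by
  have h1 : IntegrableOn (fun x : ℝ => (1 + x ^ 2) ^ (-(s / 2))) (Ioi 1) := by
    refine (integrableOn_Ioi_rpow_of_lt (a := -s) (by linarith) one_pos).mono'
      (continuous_one_add_sq_rpow s).aestronglyMeasurable ?_
    refine (ae_restrict_iff' measurableSet_Ioi).2 (.of_forall fun x hx => ?_)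
    rw [norm_of_nonneg (rpow_nonneg (one_add_sq_pos x).le _)]
    exact one_add_sq_rpow_le (by linarith) (zero_lt_one.trans hx)
  have h2 : IntegrableOn (fun x : ℝ => (1 + x ^ 2) ^ (-(s / 2))) (Ioc c 1) :=
    ((continuous_one_add_sq_rpow s).integrableOn_Icc).mono_set Ioc_subset_Icc_self
  exact (h2.union h1).mono_set fun x hx => by
    rcases le_or_gt x 1 with h | h
    · exact Or.inl ⟨hx, h⟩
    · exact Or.inr h

lemma setIntegral_Ioi_one_add_sq_le {s c : ℝ} (hs : 1 < s) (hc : 0 < c) :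
    ∫ x in Ioi c, (1 + x ^ 2) ^ (-(s / 2)) ≤ c ^ (1 - s) / (s - 1) := by
  have h := setIntegral_mono_on (integrableOn_one_add_sq_Ioi hs c)
    (integrableOn_Ioi_rpow_of_lt (a := -s) (by linarith) hc) measurableSet_Ioi
    fun x hx => one_add_sq_rpow_le (by linarith) (hc.trans hx)
  rw [integral_Ioi_rpow_of_lt (by linarith) hc] at h
  refine h.trans (le_of_eq ?_)
  rw [show -s + 1 = -(s - 1) by ring, neg_div_neg_eq, show -(s - 1) = 1 - s by ring]

lemma poleIntegral_eq_add {s c : ℝ} (hs : 1 < s) (hc : 0 ≤ c) :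
    poleIntegral s = (∫ x in (0 : ℝ)..c, (1 + x ^ 2) ^ (-(s / 2))) +
      ∫ x in Ioi c, (1 + x ^ 2) ^ (-(s / 2)) := by
  unfold poleIntegral
  rw [intervalIntegral.integral_of_le hc, ← setIntegral_union Ioc_disjoint_Ioi_same
    measurableSet_Ioi ((integrableOn_one_add_sq_Ioi hs 0).mono_set Ioc_subset_Ioi_self)
    (integrableOn_one_add_sq_Ioi hs c), Ioc_union_Ioi_eq_Ioi hc]

lemma one_add_sq_rpow_le_one {s x : ℝ} (hs : 0 ≤ s) : (1 + x ^ 2) ^ (-(s / 2)) ≤ 1 :=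
  rpow_le_one_of_one_le_of_nonpos (by nlinarith [sq_nonneg x]) (by linarith)

/-- The value `s/(s-1)` is the conjugate exponent; it produces `(s')^{1/s}` in the error term. -/
lemma poleIntegral_le {s : ℝ} (hs : 1 < s) : poleIntegral s ≤ s / (s - 1) := by
  rw [poleIntegral_eq_add hs zero_le_one]
  have h1 := setIntegral_Ioi_one_add_sq_le hs one_pos
  have h2 : ∫ x in (0 : ℝ)..1, (1 + x ^ 2) ^ (-(s / 2)) ≤ ∫ x in (0 : ℝ)..1, (1 : ℝ) :=
    intervalIntegral.integral_mono_on zero_le_one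
      ((continuous_one_add_sq_rpow s).intervalIntegrable _ _) (by simp)
      fun x _ => one_add_sq_rpow_le_one (by linarith)
  simp only [intervalIntegral.integral_const, sub_zero, smul_eq_mul, mul_one, one_rpow] at h1 h2
  have : s / (s - 1) = 1 + 1 / (s - 1) := by
    have : s - 1 ≠ 0 := by linarith
    field_simp; ring
  linarith

lemma half_le_poleIntegral {s : ℝ} (hs : 1 < s) (hs2 : s ≤ 2) : 1 / 2 ≤ poleIntegral s := by
  rw [poleIntegral_eq_add hs zero_le_one]
  have h1 : 0 ≤ ∫ x in Ioi (1 : ℝ), (1 + x ^ 2) ^ (-(s / 2)) :=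
    integral_nonneg fun x => rpow_nonneg (one_add_sq_pos x).le _
  have h2 : ∫ x in (0 : ℝ)..1, (1 / 2 : ℝ) ≤ ∫ x in (0 : ℝ)..1, (1 + x ^ 2) ^ (-(s / 2)) := by
    refine intervalIntegral.integral_mono_on zero_le_one (by simp)
      ((continuous_one_add_sq_rpow s).intervalIntegrable _ _) fun x hx => ?_
    have hx2 : 1 + x ^ 2 ≤ 2 := by nlinarith [hx.1, hx.2]
    calc (1 / 2 : ℝ) = 2 ^ (-1 : ℝ) := by rw [rpow_neg_one]; norm_num
      _ ≤ 2 ^ (-(s / 2)) := rpow_le_rpow_of_exponent_le one_le_two (by linarith)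
      _ ≤ _ := rpow_le_rpow_of_nonpos (one_add_sq_pos x) hx2 (by linarith)
  simp only [intervalIntegral.integral_const, sub_zero, smul_eq_mul, one_mul] at h2
  linarith

lemma poleIntegral_pos {s : ℝ} (hs : 1 < s) : 0 < poleIntegral s := by
  rw [poleIntegral_eq_add hs zero_le_one]
  have h1 : 0 ≤ ∫ x in Ioi (1 : ℝ), (1 + x ^ 2) ^ (-(s / 2)) :=
    integral_nonneg fun x => rpow_nonneg (one_add_sq_pos x).le _
  have h2 : 0 < ∫ x in (0 : ℝ)..1, (1 + x ^ 2) ^ (-(s / 2)) :=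
    intervalIntegral.intervalIntegral_pos_of_pos
      ((continuous_one_add_sq_rpow s).intervalIntegrable _ _)
      (fun x => rpow_pos_of_pos (one_add_sq_pos x) _) one_pos
  linarith

lemma image_div_sqrt_one_add_sq :
    (fun x : ℝ => x / √(1 + x ^ 2)) '' Ioi 0 = Ioo 0 1 := by
  ext t
  constructor
  · rintro ⟨x, hx, rfl⟩
    have hx : 0 < x := hx
    have h0 := sqrt_pos.2 (one_add_sq_pos x)
    refine ⟨by positivity, (div_lt_one h0).2 ?_⟩
    exact lt_sqrt_of_sq_lt (by linarith)
  · rintro ⟨h0, h1⟩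
    have h2 : 0 < 1 - t ^ 2 := by nlinarith
    refine ⟨t / √(1 - t ^ 2), div_pos h0 (sqrt_pos.2 h2), ?_⟩
    have h3 : 1 + (t / √(1 - t ^ 2)) ^ 2 = 1 / (1 - t ^ 2) := by
      rw [div_pow, sq_sqrt h2.le]; field_simp; ring
    simp only [h3]
    rw [sqrt_div zero_le_one, sqrt_one]
    have := sqrt_pos.2 h2
    field_simp

lemma hasDerivAt_div_sqrt_one_add_sq (x : ℝ) :
    HasDerivAt (fun x : ℝ => x / √(1 + x ^ 2)) ((1 + x ^ 2) ^ (-(3 / 2) : ℝ)) x := by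
  have h0 := one_add_sq_pos x
  have hs := sqrt_pos.2 h0
  have h1 : HasDerivAt (fun x : ℝ => 1 + x ^ 2) (2 * x) x := by
    simpa using (hasDerivAt_pow 2 x).const_add 1
  have h2 := (hasDerivAt_id x).div (h1.sqrt h0.ne') hs.ne'
  refine h2.congr_deriv ?_
  have h3 : (1 + x ^ 2) ^ (-(3 / 2) : ℝ) = 1 / (√(1 + x ^ 2) ^ 3) := by
    rw [rpow_neg h0.le, sqrt_eq_rpow, ← rpow_mul_natCast h0.le]; norm_num
  rw [h3]
  have h4 : √(1 + x ^ 2) ^ 2 = 1 + x ^ 2 := sq_sqrt h0.le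
  simp only [id]
  field_simp
  rw [h4]; ring

/-- Substitute `t = x/√(1 + x²)`: then `1 - t² = (1 + x²)⁻¹`, `dt = (1 + x²)^{-3/2} dx`, and the
exponents add up to `-s/2`. -/
lemma hypergeometric_eq_poleIntegral {s : ℝ} (hs : 1 < s) :
    ordinaryHypergeometric (1 / 2 : ℝ) ((3 - s) / 2) (3 / 2) (1 : ℝ) = poleIntegral s := by
  rw [hypergeometric_eq_integral (by linarith), ← image_div_sqrt_one_add_sq,
    integral_image_eq_integral_abs_deriv_smul measurableSet_Ioi
      (fun x _ => (hasDerivAt_div_sqrt_one_add_sq x).hasDerivWithinAt)]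
  · unfold poleIntegral
    refine setIntegral_congr_fun measurableSet_Ioi fun x hx => ?_
    have h0 := one_add_sq_pos x
    have h1 : 1 - (x / √(1 + x ^ 2)) ^ 2 = (1 + x ^ 2)⁻¹ := by
      rw [div_pow, sq_sqrt h0.le]; field_simp; ring
    simp only [smul_eq_mul]
    rw [h1, abs_of_pos (rpow_pos_of_pos h0 _), inv_rpow h0.le, ← rpow_neg h0.le, ← rpow_add h0]
    congr 1; ring
  · refine (strictMono_of_hasDerivAt_pos hasDerivAt_div_sqrt_one_add_sq
      fun x => rpow_pos_of_pos (one_add_sq_pos x) _).injective.injOn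

lemma integral_norm_poleKernel_rpow {s a : ℝ} (ha : 0 < a) :
    ∫ t in (-π)..π, ‖poleKernel a t‖ ^ s =
      2 * a ^ (1 - s) * ∫ x in (0 : ℝ)..(π / a), (1 + x ^ 2) ^ (-(s / 2)) := by
  have h1 : ∀ t, ‖poleKernel a t‖ ^ s = a ^ (-s) * (1 + (t / a) ^ 2) ^ (-(s / 2)) := by
    intro t
    have e : ‖(a : ℂ) - t * Complex.I‖ = a * (1 + (t / a) ^ 2) ^ (1 / 2 : ℝ) := by
      rw [Complex.norm_eq_sqrt_sq_add_sq, ← sqrt_eq_rpow]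
      have : a = √(a ^ 2) := (sqrt_sq ha.le).symm
      conv_rhs => rw [this]
      rw [← sqrt_mul (sq_nonneg _)]
      congr 1
      simp
      field_simp
      rw [sq_sqrt (sq_nonneg a)]
      ring
    have h0 := one_add_sq_pos (t / a)
    rw [poleKernel, norm_inv, e, inv_rpow (by positivity), ← rpow_neg (by positivity),
      mul_rpow ha.le (by positivity), ← rpow_mul h0.le]
    congr 2; ring
  have hi := fun b c => (continuous_one_add_sq_rpow s).intervalIntegrable (μ := volume) b c
  have h2 : ∫ x in (-(π / a))..0, (1 + x ^ 2) ^ (-(s / 2)) =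
      ∫ x in (0 : ℝ)..(π / a), (1 + x ^ 2) ^ (-(s / 2)) := by
    have := intervalIntegral.integral_comp_neg (a := 0) (b := π / a)
      (fun x : ℝ => (1 + x ^ 2) ^ (-(s / 2)))
    rw [neg_zero] at this
    rw [← this]
    simp
  simp_rw [h1]
  rw [intervalIntegral.integral_const_mul,
    intervalIntegral.integral_comp_div (fun x : ℝ => (1 + x ^ 2) ^ (-(s / 2))) ha.ne',
    neg_div, ← intervalIntegral.integral_add_adjacent_intervals (hi _ 0) (hi 0 _), h2,
    sub_eq_add_neg, rpow_add ha, rpow_one, smul_eq_mul]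
  ring

/-! ### Norms over a period -/

/-- Lebesgue measure on the period `[0, 2π)`. -/
abbrev circleMeasure : Measure ℝ := volume.restrict (Ico 0 (2 * π))

/-- The `L_s`-norm over a period of a function with values in a normed group. -/
def circleNorm {E : Type*} [NormedAddCommGroup E] (s : ℝ) (f : ℝ → E) : ℝ≥0∞ :=
  eLpNorm f (ENNReal.ofReal s) circleMeasure

lemma circleMeasure_univ : circleMeasure univ = ENNReal.ofReal (2 * π) := by simp

lemma lintegral_circle_eq_Ioc {g : ℝ → ℝ≥0∞} (hg : Function.Periodic g (2 * π)) (c : ℝ) :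
    ∫⁻ x, g x ∂circleMeasure = ∫⁻ x in Ioc c (c + 2 * π), g x := by
  have h : ∫⁻ x in Ioc 0 (0 + 2 * π), g x = ∫⁻ x in Ioc c (c + 2 * π), g x :=
    IsAddFundamentalDomain.setLIntegral_eq (isAddFundamentalDomain_Ioc two_pi_pos 0)
      (isAddFundamentalDomain_Ioc two_pi_pos c) g hg.map_vadd_zmultiples
  rw [← h, zero_add, circleMeasure, Measure.restrict_congr_set Ico_ae_eq_Ioc]

lemma lintegral_circle_add {g : ℝ → ℝ≥0∞} (hg : Function.Periodic g (2 * π)) (hm : Measurable g)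
    (h : ℝ) : ∫⁻ x, g (x + h) ∂circleMeasure = ∫⁻ x, g x ∂circleMeasure := by
  have h1 := (measurePreserving_add_right (volume : Measure ℝ) h).setLIntegral_comp_preimage
    (measurableSet_Ico (a := h) (b := h + 2 * π)) hm
  have h2 : (fun x => x + h) ⁻¹' Ico h (h + 2 * π) = Ico 0 (2 * π) := by
    ext x; simp only [mem_preimage, mem_Ico]; constructor <;> rintro ⟨_, _⟩ <;> constructor <;> linarith
  rw [h2] at h1
  rw [h1, lintegral_circle_eq_Ioc hg h, Measure.restrict_congr_set Ico_ae_eq_Ioc]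

section Norm

variable {E F : Type*} [NormedAddCommGroup E] [NormedAddCommGroup F] {s : ℝ}

lemma circleNorm_eq_lintegral (hs : 1 < s) (f : ℝ → E) :
    circleNorm s f = (∫⁻ x, ‖f x‖ₑ ^ s ∂circleMeasure) ^ (1 / s) := by
  rw [circleNorm, eLpNorm_eq_lintegral_rpow_enorm_toReal (by simp; linarith) ENNReal.ofReal_ne_top,
    ENNReal.toReal_ofReal (by linarith)]

lemma circleNorm_rpow (hs : 1 < s) (f : ℝ → E) :
    circleNorm s f ^ s = ∫⁻ x, ‖f x‖ₑ ^ s ∂circleMeasure := by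
  rw [circleNorm_eq_lintegral hs, ← ENNReal.rpow_mul, one_div, inv_mul_cancel₀ (by linarith),
    ENNReal.rpow_one]

lemma circleNorm_mono {f : ℝ → E} {g : ℝ → F} (h : ∀ x, ‖f x‖ ≤ ‖g x‖) :
    circleNorm s f ≤ circleNorm s g := eLpNorm_mono h

lemma circleNorm_add_le (hs : 1 < s) {f g : ℝ → E} (hf : Continuous f) (hg : Continuous g) :
    circleNorm s (fun x => f x + g x) ≤ circleNorm s f + circleNorm s g :=
  eLpNorm_add_le hf.aestronglyMeasurable hg.aestronglyMeasurable (by simpa using hs.le)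

lemma circleNorm_sub_le (hs : 1 < s) {f g : ℝ → E} (hf : Continuous f) (hg : Continuous g) :
    circleNorm s (fun x => f x - g x) ≤ circleNorm s f + circleNorm s g :=
  eLpNorm_sub_le hf.aestronglyMeasurable hg.aestronglyMeasurable (by simpa using hs.le)

lemma circleNorm_comp_add (hs : 1 < s) {f : ℝ → E} (hf : Continuous f)
    (hp : Function.Periodic f (2 * π)) (h : ℝ) :
    circleNorm s (fun x => f (x + h)) = circleNorm s f := by
  rw [circleNorm_eq_lintegral hs, circleNorm_eq_lintegral hs,
    lintegral_circle_add (g := fun x => ‖f x‖ₑ ^ s) (fun x => by simp only [hp x])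
      (hf.enorm.measurable.pow_const s)]

/-- The pointwise kernel estimates hold for `|t| ≤ π`, hence the passage to the symmetric period. -/
lemma circleNorm_eq_Ioc (hs : 1 < s) {f : ℝ → E} (hp : Function.Periodic f (2 * π)) :
    circleNorm s f = eLpNorm f (ENNReal.ofReal s) (volume.restrict (Ioc (-π) π)) := by
  rw [circleNorm_eq_lintegral hs, eLpNorm_eq_lintegral_rpow_enorm_toReal (by simp; linarith)
    ENNReal.ofReal_ne_top, ENNReal.toReal_ofReal (by linarith),
    lintegral_circle_eq_Ioc (g := fun x => ‖f x‖ₑ ^ s) (fun x => by simp only [hp x]) (-π)]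
  congr; ring

lemma circleNorm_const_mul (c : ℝ) (f : ℝ → ℝ) :
    circleNorm s (fun x => c * f x) = ENNReal.ofReal |c| * circleNorm s f := by
  have := eLpNorm_const_smul c f (ENNReal.ofReal s) circleMeasure
  rw [← norm_eq_abs, ofReal_norm]
  exact this

lemma circleNorm_ne_top {f : ℝ → E} (hf : Continuous f) : circleNorm s f ≠ ∞ := by
  obtain ⟨C, hC⟩ := (isCompact_Icc (a := (0 : ℝ)) (b := 2 * π)).exists_bound_of_continuousOn
    hf.continuousOn
  refine (MemLp.of_bound (C := C) hf.aestronglyMeasurable ?_).2.ne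
  exact (ae_restrict_iff' measurableSet_Ico).2
    (.of_forall fun x hx => hC x (Ico_subset_Icc_self hx))

lemma two_pi_rpow_le (hs : 1 < s) : ENNReal.ofReal (2 * π) ^ (1 / s) ≤ ENNReal.ofReal (2 * π) := by
  conv_rhs => rw [← ENNReal.rpow_one (ENNReal.ofReal (2 * π))]
  refine ENNReal.rpow_le_rpow_of_exponent_le ?_ ((div_le_one (by linarith)).2 hs.le)
  rw [ENNReal.one_le_ofReal]
  linarith [pi_gt_three]

lemma circleNorm_const_le (hs : 1 < s) {f : ℝ → E} {c : ℝ} (h : ∀ x, ‖f x‖ ≤ c) :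
    circleNorm s f ≤ ENNReal.ofReal (2 * π * c) := by
  have hc : 0 ≤ c := (norm_nonneg _).trans (h 0)
  have h1 : circleNorm s f ≤ eLpNorm (fun _ : ℝ => c) (ENNReal.ofReal s) circleMeasure :=
    eLpNorm_mono fun x => (h x).trans (le_abs_self c)
  refine h1.trans ?_
  rw [eLpNorm_const c (by simp; linarith) (by
    rw [← Measure.measure_univ_ne_zero, circleMeasure_univ]; simp [pi_pos]),
    circleMeasure_univ, ENNReal.toReal_ofReal (by linarith), enorm_eq_ofReal hc, mul_comm,
    ENNReal.ofReal_mul two_pi_pos.le]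
  gcongr
  exact two_pi_rpow_le hs

end Norm

/-! ### Young's inequality with an integrable factor -/

section Young

variable {s : ℝ}

/-- The density `|φ|` defines a measure `ν` of mass at most one, for which the `L_1` norm is at most
the `L_s` norm. Tonelli's theorem and translation invariance finish the estimate. -/
lemma circleNorm_convolution_le (hs : 1 < s) {P φ : ℝ → ℝ} (hP : Continuous P)
    (hper : Function.Periodic P (2 * π)) (hφ : AEStronglyMeasurable φ circleMeasure)
    (h1 : ∫⁻ t, ‖φ t‖ₑ ∂circleMeasure ≤ 1) :
    circleNorm s (fun x => ∫ t, P (x - t) * φ t ∂circleMeasure) ≤ circleNorm s P := by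
  set ν := circleMeasure.withDensity fun t => ‖φ t‖ₑ with hν
  have hν1 : ν univ ≤ 1 := by rwa [hν, withDensity_apply _ MeasurableSet.univ, Measure.restrict_univ]
  have : IsFiniteMeasure ν := ⟨hν1.trans_lt ENNReal.one_lt_top⟩
  have hs0 : 0 < s := by linarith
  have hpt : ∀ x, ‖∫ t, P (x - t) * φ t ∂circleMeasure‖ₑ ^ s ≤ ∫⁻ t, ‖P (x - t)‖ₑ ^ s ∂ν := by
    intro x
    have hc : Continuous fun t => P (x - t) := by fun_prop
    have e1 : ‖∫ t, P (x - t) * φ t ∂circleMeasure‖ₑ ≤ ∫⁻ t, ‖P (x - t)‖ₑ ∂ν := by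
      refine (enorm_integral_le_lintegral_enorm _).trans (le_of_eq ?_)
      rw [hν, lintegral_withDensity_eq_lintegral_mul₀ hφ.enorm hc.enorm.measurable.aemeasurable]
      refine lintegral_congr fun t => ?_
      rw [enorm_mul, Pi.mul_apply, mul_comm]
    have e2 : ∫⁻ t, ‖P (x - t)‖ₑ ∂ν ≤ eLpNorm (fun t => P (x - t)) (ENNReal.ofReal s) ν := by
      rw [← eLpNorm_one_eq_lintegral_enorm]
      refine (eLpNorm_le_eLpNorm_mul_rpow_measure_univ (q := ENNReal.ofReal s) (by simpa using hs.le)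
        hc.aestronglyMeasurable).trans ?_
      refine mul_le_of_le_one_right' (ENNReal.rpow_le_one hν1 ?_)
      rw [ENNReal.toReal_one, ENNReal.toReal_ofReal hs0.le, sub_nonneg, div_one, div_le_one hs0]
      exact hs.le
    refine (ENNReal.rpow_le_rpow (e1.trans e2) hs0.le).trans (le_of_eq ?_)
    rw [eLpNorm_eq_lintegral_rpow_enorm_toReal (by simp; linarith)
      ENNReal.ofReal_ne_top, ENNReal.toReal_ofReal hs0.le, ← ENNReal.rpow_mul, one_div,
      inv_mul_cancel₀ hs0.ne', ENNReal.rpow_one]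
  rw [← ENNReal.rpow_le_rpow_iff hs0, circleNorm_rpow hs, circleNorm_rpow hs]
  calc _ ≤ ∫⁻ x, ∫⁻ t, ‖P (x - t)‖ₑ ^ s ∂ν ∂circleMeasure := lintegral_mono hpt
    _ = ∫⁻ t, ∫⁻ x, ‖P (x - t)‖ₑ ^ s ∂circleMeasure ∂ν := by
        refine lintegral_lintegral_swap (Measurable.aemeasurable ?_)
        have : Continuous fun z : ℝ × ℝ => P (z.1 - z.2) := by fun_prop
        exact this.enorm.measurable.pow_const s
    _ = ∫⁻ t, (∫⁻ x, ‖P x‖ₑ ^ s ∂circleMeasure) ∂ν := by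
        refine lintegral_congr fun t => ?_
        simp_rw [sub_eq_add_neg]
        exact lintegral_circle_add (g := fun x => ‖P x‖ₑ ^ s) (fun x => by simp only [hper x])
          (hP.enorm.measurable.pow_const s) (-t)
    _ ≤ _ := by
        rw [lintegral_const]
        exact mul_le_of_le_one_right' hν1

end Young

/-! ### Averaging over the phase of a fast carrier -/

section Averaging

variable {s : ℝ} {n : ℕ} {G : ℝ → ℂ}

/-- The oscillating real function `Re (e^{i (n t - θ)} G t)`. -/
def modulated (n : ℕ) (θ : ℝ) (G : ℝ → ℂ) (t : ℝ) : ℝ :=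
  (Complex.exp ((n * t - θ : ℝ) * Complex.I) * G t).re

lemma continuous_modulated (θ : ℝ) (hG : Continuous G) : Continuous (modulated n θ G) := by
  unfold modulated
  exact Complex.continuous_re.comp (by fun_prop)

lemma abs_modulated_le (θ t : ℝ) : |modulated n θ G t| ≤ ‖G t‖ := by
  refine (Complex.abs_re_le_norm _).trans ?_
  rw [norm_mul, Complex.norm_exp_ofReal_mul_I, one_mul]

lemma modulated_add (θ : ℝ) (G H : ℝ → ℂ) (t : ℝ) :
    modulated n θ (fun x => G x + H x) t = modulated n θ G t + modulated n θ H t := by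
  simp only [modulated, mul_add, Complex.add_re]

lemma periodic_modulated (θ : ℝ) (hp : Function.Periodic G (2 * π)) :
    Function.Periodic (modulated n θ G) (2 * π) := by
  intro t
  unfold modulated
  rw [hp t]
  have : ((n * (t + 2 * π) - θ : ℝ) : ℂ) * Complex.I =
      (n * t - θ : ℝ) * Complex.I + n * (2 * π * Complex.I) := by push_cast; ring
  rw [this, Complex.exp_add, Complex.exp_nat_mul_two_pi_mul_I, mul_one]

lemma modulated_eq_cos (θ t : ℝ) :
    modulated n θ G t = ‖G t‖ * cos (n * t - θ + (G t).arg) := by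
  unfold modulated
  conv_lhs => rw [← Complex.norm_mul_exp_arg_mul_I (G t)]
  rw [mul_left_comm, ← Complex.exp_add, ← add_mul, ← Complex.ofReal_add, Complex.re_ofReal_mul,
    Complex.exp_ofReal_mul_I_re]

lemma lintegral_abs_cos_sub (hs : 1 < s) (c : ℝ) :
    ∫⁻ φ, ‖cos (c - φ)‖ₑ ^ s ∂circleMeasure = circleNorm s cos ^ s := by
  have h1 := lintegral_circle_add (g := fun x => ‖cos x‖ₑ ^ s)
    (fun x => by simp only [cos_add_two_pi]) (continuous_cos.enorm.measurable.pow_const s) (-c)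
  rw [circleNorm_rpow hs, ← h1]
  refine lintegral_congr fun x => ?_
  rw [← cos_neg]; congr 3; ring

/-- After interchanging the integrals, the phase runs over a full period for each fixed `t`, so the
argument of `G t` no longer matters. -/
lemma lintegral_circleNorm_modulated (hs : 1 < s) (hG : Continuous G) (θ : ℝ) :
    ∫⁻ φ, circleNorm s (modulated n (θ + φ) G) ^ s ∂circleMeasure =
      (circleNorm s cos * circleNorm s G) ^ s := by
  have hs0 : 0 < s := by linarith
  simp_rw [circleNorm_rpow hs (modulated _ _ _)]
  rw [lintegral_lintegral_swap]
  · have : ∀ t, ∫⁻ φ, ‖modulated n (θ + φ) G t‖ₑ ^ s ∂circleMeasure =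
        ‖G t‖ₑ ^ s * circleNorm s cos ^ s := by
      intro t
      rw [← lintegral_abs_cos_sub hs (n * t - θ + (G t).arg), ← lintegral_const_mul']
      · refine lintegral_congr fun φ => ?_
        rw [modulated_eq_cos, enorm_mul, enorm_norm, ENNReal.mul_rpow_of_nonneg _ _ hs0.le]
        congr 4; ring
      · exact ENNReal.rpow_ne_top_of_nonneg hs0.le enorm_ne_top
    simp_rw [this]
    rw [lintegral_mul_const', ← circleNorm_rpow hs, ENNReal.mul_rpow_of_nonneg _ _ hs0.le, mul_comm]
    exact ENNReal.rpow_ne_top_of_nonneg hs0.le (circleNorm_ne_top continuous_cos)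
  · have : Continuous fun z : ℝ × ℝ => modulated n (θ + z.1) G z.2 := by
      unfold modulated
      exact Complex.continuous_re.comp (by fun_prop)
    exact (this.enorm.measurable.pow_const s).aemeasurable

/-- The translation `h = (θ' - θ)/n` satisfies `n(t + h) - θ' = nt - θ`: it absorbs the change of
phase and leaves only an increment of `G`. -/
lemma circleNorm_modulated_le (hs : 1 < s) (hn : 1 ≤ n) (hG : Continuous G)
    (hp : Function.Periodic G (2 * π)) {Δ : ℝ≥0∞}
    (hΔ : ∀ h, |h| ≤ 2 * π / n → circleNorm s (fun t => G (t + h) - G t) ≤ Δ) {θ θ' : ℝ}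
    (hθ : |θ' - θ| ≤ 2 * π) :
    circleNorm s (modulated n θ' G) ≤ circleNorm s (modulated n θ G) + Δ := by
  have hn' : (0 : ℝ) < n := by exact_mod_cast hn
  set h := (θ' - θ) / n with hh
  have hGh : Continuous fun t => G (t + h) - G t := by fun_prop
  rw [← circleNorm_comp_add hs (continuous_modulated θ' hG) (periodic_modulated θ' hp) h]
  have e : ∀ t, modulated n θ' G (t + h) =
      modulated n θ G t + modulated n θ (fun t => G (t + h) - G t) t := by
    intro t
    rw [← modulated_add]
    simp only [modulated, add_sub_cancel]
    congr 5
    rw [hh]; field_simp; ring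
  simp_rw [e]
  refine (circleNorm_add_le hs (continuous_modulated θ hG) (continuous_modulated θ hGh)).trans ?_
  gcongr
  refine (circleNorm_mono fun x => abs_modulated_le θ x).trans (hΔ h ?_)
  rw [hh, abs_div, abs_of_pos hn']
  gcongr

/-- All phases have norms within `Δ` of each other, hence each is within `Δ` of the mean; `2π` is
the total mass of the phases. -/
lemma circleNorm_modulated_bounds (hs : 1 < s) (hn : 1 ≤ n) (hG : Continuous G)
    (hp : Function.Periodic G (2 * π)) {Δ : ℝ≥0∞}
    (hΔ : ∀ h, |h| ≤ 2 * π / n → circleNorm s (fun t => G (t + h) - G t) ≤ Δ) (θ : ℝ) :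
    circleNorm s cos * circleNorm s G ≤
        ENNReal.ofReal (2 * π) ^ (1 / s) * (circleNorm s (modulated n θ G) + Δ) ∧
      ENNReal.ofReal (2 * π) ^ (1 / s) * circleNorm s (modulated n θ G) ≤
        circleNorm s cos * circleNorm s G + ENNReal.ofReal (2 * π) ^ (1 / s) * Δ := by
  have hs0 : 0 < s := by linarith
  have hav := lintegral_circleNorm_modulated (n := n) hs hG θ
  have hroot : ∀ A : ℝ≥0∞, (ENNReal.ofReal (2 * π) ^ (1 / s) * A) ^ s =
      ∫⁻ _, A ^ s ∂circleMeasure := by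
    intro A
    rw [lintegral_const, circleMeasure_univ, ENNReal.mul_rpow_of_nonneg _ _ hs0.le,
      ← ENNReal.rpow_mul, one_div, inv_mul_cancel₀ hs0.ne', ENNReal.rpow_one, mul_comm]
  have habs : ∀ φ ∈ Ico 0 (2 * π), |φ| ≤ 2 * π := fun φ hφ => by
    rw [abs_of_nonneg hφ.1]; exact hφ.2.le
  constructor
  · rw [← ENNReal.rpow_le_rpow_iff hs0, hroot, ← hav]
    refine setLIntegral_mono' measurableSet_Ico fun φ hφ => ?_
    refine ENNReal.rpow_le_rpow (circleNorm_modulated_le hs hn hG hp hΔ ?_) hs0.le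
    simpa using habs φ hφ
  -- Subtracting `Δ` on the left first allows the comparison to be made under the integral; the
  -- truncation of the subtraction does no harm in this direction.
  · rw [← tsub_le_iff_right, ← ENNReal.mul_sub (by
      intros; exact ENNReal.rpow_ne_top_of_nonneg (by positivity) ENNReal.ofReal_ne_top),
      ← ENNReal.rpow_le_rpow_iff hs0, hroot, ← hav]
    refine setLIntegral_mono' measurableSet_Ico fun φ hφ => ?_
    refine ENNReal.rpow_le_rpow (tsub_le_iff_right.2 ?_) hs0.le
    refine circleNorm_modulated_le hs hn hG hp hΔ ?_
    simpa using habs φ hφ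

end Averaging

/-! ### Orthogonality and Fourier sums -/

section Orthogonality

lemma integral_cos_intCast_mul_add {k : ℤ} (hk : k ≠ 0) (c : ℝ) :
    ∫ t in (-π)..π, cos ((k : ℝ) * t + c) = 0 := by
  have hk' : (k : ℝ) ≠ 0 := by exact_mod_cast hk
  rw [intervalIntegral.integral_comp_mul_add (fun u => cos u) hk', integral_cos]
  have : (k : ℝ) * π + c = ((k : ℝ) * -π + c) + k * (2 * π) := by ring
  rw [this, sin_add_int_mul_two_pi, sub_self, smul_zero]

lemma integral_cos_mul_cos_of_ne {j k : ℕ} (h : j ≠ k) (c d : ℝ) :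
    ∫ t in (-π)..π, cos ((j : ℝ) * t + c) * cos ((k : ℝ) * t + d) = 0 := by
  have e : ∀ t : ℝ, cos ((j : ℝ) * t + c) * cos ((k : ℝ) * t + d) =
      (cos (((j - k : ℤ) : ℝ) * t + (c - d)) + cos (((j + k : ℤ) : ℝ) * t + (c + d))) / 2 := by
    intro t
    have h1 := cos_sub ((j : ℝ) * t + c) ((k : ℝ) * t + d)
    have h2 := cos_add ((j : ℝ) * t + c) ((k : ℝ) * t + d)
    have e1 : (((j - k : ℤ) : ℝ) * t + (c - d)) = (j : ℝ) * t + c - ((k : ℝ) * t + d) := by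
      push_cast; ring
    have e2 : (((j + k : ℤ) : ℝ) * t + (c + d)) = (j : ℝ) * t + c + ((k : ℝ) * t + d) := by
      push_cast; ring
    rw [e1, e2, h1, h2]; ring
  simp_rw [e]
  rw [intervalIntegral.integral_div, intervalIntegral.integral_add
    (by apply Continuous.intervalIntegrable; fun_prop)
    (by apply Continuous.intervalIntegrable; fun_prop),
    integral_cos_intCast_mul_add (by omega), integral_cos_intCast_mul_add (by omega)]
  simp

lemma integral_cos_mul_cos_same {k : ℕ} (hk : k ≠ 0) (c d : ℝ) :
    ∫ t in (-π)..π, cos ((k : ℝ) * t + c) * cos ((k : ℝ) * t + d) = π * cos (c - d) := by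
  have e : ∀ t : ℝ, cos ((k : ℝ) * t + c) * cos ((k : ℝ) * t + d) =
      (cos (c - d) + cos (((k + k : ℤ) : ℝ) * t + (c + d))) / 2 := by
    intro t
    have h1 := cos_sub ((k : ℝ) * t + c) ((k : ℝ) * t + d)
    have h2 := cos_add ((k : ℝ) * t + c) ((k : ℝ) * t + d)
    have e1 : c - d = (k : ℝ) * t + c - ((k : ℝ) * t + d) := by ring
    have e2 : (((k + k : ℤ) : ℝ) * t + (c + d)) = (k : ℝ) * t + c + ((k : ℝ) * t + d) := by
      push_cast; ring
    rw [e1, e2, h1, h2]; ring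
  simp_rw [e]
  rw [intervalIntegral.integral_div, intervalIntegral.integral_add
    (by apply Continuous.intervalIntegrable; fun_prop)
    (by apply Continuous.intervalIntegrable; fun_prop),
    integral_cos_intCast_mul_add (by omega)]
  simp only [intervalIntegral.integral_const, smul_eq_mul]
  ring

end Orthogonality

/-- A trigonometric polynomial of order `m`. -/
def trigPoly (m : ℕ) (c : ℝ) (A B : ℕ → ℝ) (x : ℝ) : ℝ :=
  c / 2 + ∑ k ∈ Finset.Icc 1 m, (A k * cos ((k : ℝ) * x) + B k * sin ((k : ℝ) * x))

lemma continuous_trigPoly (m : ℕ) (c : ℝ) (A B : ℕ → ℝ) : Continuous (trigPoly m c A B) := by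
  unfold trigPoly; fun_prop

/-- Sines are written as cosines with phase `-π/2`, so that one family of orthogonality relations
covers everything. -/
lemma integral_trigPoly_mul_cos (m : ℕ) (c : ℝ) (A B : ℕ → ℝ) (k : ℕ) (d : ℝ) :
    ∫ t in (-π)..π, trigPoly m c A B t * cos ((k : ℝ) * t + d) =
      c / 2 * (∫ t in (-π)..π, cos ((k : ℝ) * t + d)) +
      ∑ j ∈ Finset.Icc 1 m, (A j * (∫ t in (-π)..π, cos ((j : ℝ) * t) * cos ((k : ℝ) * t + d)) +
        B j * ∫ t in (-π)..π, cos ((j : ℝ) * t + -(π / 2)) * cos ((k : ℝ) * t + d)) := by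
  simp only [trigPoly, add_mul, Finset.sum_mul, ← sub_eq_add_neg, cos_sub_pi_div_two, mul_assoc]
  rw [intervalIntegral.integral_add (by apply Continuous.intervalIntegrable; fun_prop)
    (by apply Continuous.intervalIntegrable; fun_prop), intervalIntegral.integral_const_mul,
    intervalIntegral.integral_finsetSum
      (fun i _ => by apply Continuous.intervalIntegrable; fun_prop)]
  congr 1
  refine Finset.sum_congr rfl fun j _ => ?_
  rw [intervalIntegral.integral_add (by apply Continuous.intervalIntegrable; fun_prop)
    (by apply Continuous.intervalIntegrable; fun_prop), intervalIntegral.integral_const_mul,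
    intervalIntegral.integral_const_mul]

lemma integral_trigPoly_mul_cos_of_mem {m k : ℕ} (hk : k ∈ Finset.Icc 1 m) (c : ℝ) (A B : ℕ → ℝ)
    (d : ℝ) :
    ∫ t in (-π)..π, trigPoly m c A B t * cos ((k : ℝ) * t + d) =
      π * (A k * cos d - B k * sin d) := by
  have hk0 : k ≠ 0 := by have := (Finset.mem_Icc.1 hk).1; omega
  have hcc : ∀ j : ℕ, ∫ t in (-π)..π, cos ((j : ℝ) * t) * cos ((k : ℝ) * t + d) =
      ∫ t in (-π)..π, cos ((j : ℝ) * t + 0) * cos ((k : ℝ) * t + d) := fun j => by simp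
  rw [integral_trigPoly_mul_cos, Finset.sum_eq_single k]
  · have h0 := integral_cos_intCast_mul_add (k := k) (by exact_mod_cast hk0) d
    rw [Int.cast_natCast] at h0
    rw [h0, hcc, integral_cos_mul_cos_same hk0, integral_cos_mul_cos_same hk0]
    have : cos (-(π / 2) - d) = - sin d := by
      rw [← cos_neg, neg_sub, sub_neg_eq_add, cos_add_pi_div_two]
    rw [this, zero_sub, cos_neg]; ring
  · intro j _ hj
    rw [hcc, integral_cos_mul_cos_of_ne hj, integral_cos_mul_cos_of_ne hj]; simp
  · exact fun h => absurd hk h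

lemma integral_trigPoly (m : ℕ) (c : ℝ) (A B : ℕ → ℝ) :
    ∫ t in (-π)..π, trigPoly m c A B t = π * c := by
  have h := integral_trigPoly_mul_cos m c A B 0 0
  have hcc : ∀ j : ℕ, ∫ t in (-π)..π, cos ((j : ℝ) * t) * cos (((0 : ℕ) : ℝ) * t + 0) =
      ∫ t in (-π)..π, cos ((j : ℝ) * t + 0) * cos (((0 : ℕ) : ℝ) * t + 0) := fun j => by simp
  rw [Finset.sum_eq_zero] at h
  · simp at h; rw [h]; ring
  · intro j hj
    have hj0 : j ≠ 0 := by have := (Finset.mem_Icc.1 hj).1; omega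
    rw [hcc, integral_cos_mul_cos_of_ne hj0, integral_cos_mul_cos_of_ne hj0]; simp

/-- The free phase `d` in `h0` encodes both kinds of coefficients: `d = 0` gives the cosine ones and
`d = -π/2` the sine ones. -/
lemma fourierSum_trigPoly_add (m : ℕ) (c : ℝ) (A B : ℕ → ℝ) {R : ℝ → ℝ} (hR : Continuous R)
    (h0 : ∀ k ≤ m, ∀ d : ℝ, ∫ t in (-π)..π, R t * cos ((k : ℝ) * t + d) = 0) (x : ℝ) :
    fourierSum m (fun y => trigPoly m c A B y + R y) x = trigPoly m c A B x := by
  have hq := continuous_trigPoly m c A B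
  have hint : ∀ (k : ℕ) (d : ℝ), k ≤ m →
      ∫ t in (-π)..π, (trigPoly m c A B t + R t) * cos ((k : ℝ) * t + d) =
        ∫ t in (-π)..π, trigPoly m c A B t * cos ((k : ℝ) * t + d) := by
    intro k d hk
    simp only [add_mul]
    rw [intervalIntegral.integral_add (by apply Continuous.intervalIntegrable; fun_prop)
      (by apply Continuous.intervalIntegrable; fun_prop), h0 k hk d, add_zero]
  have hpi := pi_pos.ne'
  have hc0 : fourierCosCoeff (fun y => trigPoly m c A B y + R y) 0 = c := by
    have := hint 0 0 (Nat.zero_le _)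
    simp only [Nat.cast_zero, zero_mul, zero_add, cos_zero, mul_one] at this
    simp only [fourierCosCoeff, Nat.cast_zero, zero_mul, cos_zero, mul_one]
    rw [this, integral_trigPoly]; field_simp
  have hA : ∀ k ∈ Finset.Icc 1 m,
      fourierCosCoeff (fun y => trigPoly m c A B y + R y) k = A k := by
    intro k hk
    have := hint k 0 (Finset.mem_Icc.1 hk).2
    rw [integral_trigPoly_mul_cos_of_mem hk] at this
    simp only [add_zero] at this
    rw [fourierCosCoeff, this, cos_zero, sin_zero]; field_simp; ring
  have hB : ∀ k ∈ Finset.Icc 1 m,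
      fourierSinCoeff (fun y => trigPoly m c A B y + R y) k = B k := by
    intro k hk
    have := hint k (-(π / 2)) (Finset.mem_Icc.1 hk).2
    rw [integral_trigPoly_mul_cos_of_mem hk] at this
    simp only [← sub_eq_add_neg, cos_sub_pi_div_two] at this
    rw [fourierSinCoeff, this, cos_neg, sin_neg, cos_pi_div_two, sin_pi_div_two]; field_simp; ring
  unfold fourierSum
  rw [hc0, trigPoly]
  congr 1
  refine Finset.sum_congr rfl fun k hk => ?_
  rw [hA k hk, hB k hk]

/-! ### The tail of the Poisson kernel -/

/-- The tail `∑_{k ≥ n} e^{-α k^r} cos (k t - β π / 2)` of the generalized Poisson kernel. -/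
def tailKernel (α r β : ℝ) (n : ℕ) (t : ℝ) : ℝ :=
  exp (-α * (n : ℝ) ^ r) * modulated n (β * π / 2) (trigSeries (tailCoeff α r n)) t

section Tail

variable {α r : ℝ} {n : ℕ} (β : ℝ)

lemma continuous_tailKernel (hc : Summable (tailCoeff α r n)) :
    Continuous (tailKernel α r β n) :=
  continuous_const.mul (continuous_modulated _ (continuous_trigSeries hc))

lemma periodic_tailKernel : Function.Periodic (tailKernel α r β n) (2 * π) := by
  intro t
  unfold tailKernel
  rw [periodic_modulated _ (periodic_trigSeries _)]

lemma hasSum_modulated {c : ℕ → ℝ} (hc : Summable c) (θ t : ℝ) :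
    HasSum (fun j : ℕ => c j * cos (((n + j : ℕ) : ℝ) * t - θ)) (modulated n θ (trigSeries c) t) := by
  have h := (summable_trigSeries hc t).hasSum.mul_left
    (Complex.exp ((n * t - θ : ℝ) * Complex.I))
  have h2 := Complex.hasSum_re h
  refine h2.congr_fun fun j => ?_
  rw [mul_left_comm, Complex.re_ofReal_mul, ← Complex.exp_nat_mul, ← Complex.exp_add]
  have : ((n * t - θ : ℝ) : ℂ) * Complex.I + j * (t * Complex.I) =
      (((n + j : ℕ) : ℝ) * t - θ : ℝ) * Complex.I := by push_cast; ring
  rw [this, Complex.exp_ofReal_mul_I_re]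

lemma hasSum_tailKernel (hc : Summable (tailCoeff α r n)) (t : ℝ) :
    HasSum (fun j : ℕ => exp (-α * ((n + j : ℕ) : ℝ) ^ r) * cos (((n + j : ℕ) : ℝ) * t - β * π / 2))
      (tailKernel α r β n t) := by
  refine ((hasSum_modulated hc (β * π / 2) t).mul_left _).congr_fun fun j => ?_
  rw [tailCoeff, ← mul_assoc, ← exp_add]
  congr 2
  push_cast; ring

lemma poissonKernel_eq_sum_add (hn : 1 ≤ n) (hc : Summable (tailCoeff α r n)) (t : ℝ) :
    poissonKernel α r β t =
      ∑ k ∈ Finset.Icc 1 (n - 1), exp (-α * (k : ℝ) ^ r) * cos ((k : ℝ) * t - β * π / 2) +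
        tailKernel α r β n t := by
  -- The series of `poissonKernel` is indexed from zero with frequency `k + 1`; its first `m = n -
  -- 1` terms form the head.
  obtain ⟨m, rfl⟩ : ∃ m, n = m + 1 := ⟨n - 1, by omega⟩
  have h := hasSum_tailKernel β hc t
  set u : ℕ → ℝ := fun k => exp (-α * (k : ℝ) ^ r) * cos ((k : ℝ) * t - β * π / 2) with hu
  have h1 : HasSum (fun j => u (j + m + 1)) (tailKernel α r β (m + 1) t) := by
    refine h.congr_fun fun j => ?_
    simp only [hu]
    rw [show j + m + 1 = m + 1 + j by ring]
  have h2 := ((summable_nat_add_iff (f := fun k => u (k + 1)) m).1 h1.summable).sum_add_tsum_nat_add m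
  have h3 : poissonKernel α r β t = ∑' k, u (k + 1) := by
    unfold poissonKernel
    refine tsum_congr fun k => ?_
    simp only [hu]; push_cast; rfl
  rw [h3, ← h2, h1.tsum_eq]
  congr 1
  rw [Finset.range_eq_Ico, Finset.sum_Ico_add' u 0 m 1, zero_add, Finset.Ico_add_one_right_eq_Icc]
  rfl

lemma integral_tailKernel_mul_cos (hc : Summable (tailCoeff α r n)) {k : ℕ} (hk : k < n) (t d : ℝ) :
    ∫ x in (-π)..π, tailKernel α r β n (x - t) * cos ((k : ℝ) * x + d) = 0 := by
  have h1 : ∀ x, HasSum (fun j : ℕ => tailCoeff α r n j *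
      (cos (((n + j : ℕ) : ℝ) * x + (-(((n + j : ℕ) : ℝ) * t) - β * π / 2)) * cos ((k : ℝ) * x + d)))
      (modulated n (β * π / 2) (trigSeries (tailCoeff α r n)) (x - t) * cos ((k : ℝ) * x + d)) := by
    intro x
    refine ((hasSum_modulated hc (β * π / 2) (x - t)).mul_right _).congr_fun fun j => ?_
    rw [← mul_assoc]; congr 3; ring
  have h2 := intervalIntegral.hasSum_intervalIntegral_of_summable_norm (a := -π) (b := π)
    (f := fun j : ℕ => (⟨fun x : ℝ => tailCoeff α r n j *
      (cos (((n + j : ℕ) : ℝ) * x + (-(((n + j : ℕ) : ℝ) * t) - β * π / 2)) *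
        cos ((k : ℝ) * x + d)), by fun_prop⟩ : C(ℝ, ℝ))) (by
      refine Summable.of_nonneg_of_le (fun _ => norm_nonneg _) (fun j => ?_) hc
      refine (ContinuousMap.norm_le _ (tailCoeff_pos ..).le).2 fun x => ?_
      simp only [ContinuousMap.restrict_apply, ContinuousMap.coe_mk, norm_mul, norm_eq_abs,
        abs_of_pos (tailCoeff_pos α r n j)]
      refine mul_le_of_le_one_right (tailCoeff_pos ..).le ?_
      exact mul_le_one₀ (abs_cos_le_one _) (abs_nonneg _) (abs_cos_le_one _))
  simp only [ContinuousMap.coe_mk, intervalIntegral.integral_const_mul] at h2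
  have h3 : ∀ j : ℕ, n + j ≠ k := fun j => by omega
  simp only [integral_cos_mul_cos_of_ne (h3 _), mul_zero] at h2
  have h4 := h2.unique hasSum_zero
  simp_rw [(h1 _).tsum_eq] at h4
  simp only [tailKernel, mul_assoc, intervalIntegral.integral_const_mul]
  rw [h4, mul_zero]

end Tail

lemma integral_circle_eq {E : Type*} [NormedAddCommGroup E] [NormedSpace ℝ E] {f : ℝ → E}
    (hf : Function.Periodic f (2 * π)) :
    ∫ t in (-π)..π, f t = ∫ t, f t ∂circleMeasure := by
  have h := hf.intervalIntegral_add_eq (-π) 0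
  rw [show -π + 2 * π = π by ring, zero_add] at h
  rw [h, intervalIntegral.integral_of_le two_pi_pos.le, integral_Ioc_eq_integral_Ioo,
    circleMeasure, integral_Ico_eq_integral_Ioo]

lemma periodic_poissonKernel (α r β : ℝ) : Function.Periodic (poissonKernel α r β) (2 * π) := by
  intro t
  unfold poissonKernel
  refine tsum_congr fun k => ?_
  have : ((k : ℝ) + 1) * (t + 2 * π) - β * π / 2 =
      ((k : ℝ) + 1) * t - β * π / 2 + ((k + 1 : ℕ) : ℝ) * (2 * π) := by push_cast; ring
  rw [this, cos_add_nat_mul_two_pi]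

/-! ### The deviation as a convolution with the tail -/

section Deviation

variable {α r β : ℝ} {n : ℕ} {φ : ℝ → ℝ}

/-- The convolution of the tail kernel with `φ` over a period. -/
def tailConvolution (α r β : ℝ) (n : ℕ) (φ : ℝ → ℝ) (x : ℝ) : ℝ :=
  ∫ t, tailKernel α r β n (x - t) * φ t ∂circleMeasure

lemma abs_tailKernel_le (hc : Summable (tailCoeff α r n)) (t : ℝ) :
    |tailKernel α r β n t| ≤ exp (-α * (n : ℝ) ^ r) * ∑' j, tailCoeff α r n j := by
  rw [tailKernel, abs_mul, abs_exp]
  gcongr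
  exact (abs_modulated_le _ _).trans (norm_trigSeries_le hc (fun _ => (tailCoeff_pos ..).le) t)

lemma integrable_tailKernel_mul (hc : Summable (tailCoeff α r n))
    (hφ : Integrable φ circleMeasure) (x : ℝ) :
    Integrable (fun t => tailKernel α r β n (x - t) * φ t) circleMeasure := by
  have hT := continuous_tailKernel β hc
  exact hφ.bdd_mul (Continuous.aestronglyMeasurable (by fun_prop))
    (.of_forall fun t => abs_tailKernel_le hc _)

lemma continuous_tailConvolution (hc : Summable (tailCoeff α r n))
    (hφ : Integrable φ circleMeasure) : Continuous (tailConvolution α r β n φ) := by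
  have hT := continuous_tailKernel β hc
  refine continuous_of_dominated (fun x => (integrable_tailKernel_mul hc hφ x).1)
    (fun x => .of_forall fun t => ?_) (hφ.norm.const_mul
      (exp (-α * (n : ℝ) ^ r) * ∑' j, tailCoeff α r n j)) (.of_forall fun t => by fun_prop)
  rw [norm_mul]
  gcongr
  exact abs_tailKernel_le hc _

lemma integral_tailConvolution_mul_cos (hc : Summable (tailCoeff α r n))
    (hφ : Integrable φ circleMeasure) {k : ℕ} (hk : k < n) (d : ℝ) :
    ∫ x in (-π)..π, tailConvolution α r β n φ x * cos ((k : ℝ) * x + d) = 0 := by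
  have hT := continuous_tailKernel β hc
  rw [intervalIntegral.integral_of_le (by linarith [pi_pos])]
  simp only [tailConvolution]
  have e : ∀ x, (∫ t, tailKernel α r β n (x - t) * φ t ∂circleMeasure) * cos ((k : ℝ) * x + d) =
      ∫ t, (tailKernel α r β n (x - t) * cos ((k : ℝ) * x + d)) * φ t ∂circleMeasure := by
    intro x
    rw [← integral_mul_const]
    congr 1; ext t; ring
  simp_rw [e]
  rw [integral_integral_swap]
  · have h0 : ∀ t, ∫ x in Ioc (-π) π, tailKernel α r β n (x - t) * cos ((k : ℝ) * x + d) * φ t = 0 := by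
      intro t
      rw [integral_mul_const, ← intervalIntegral.integral_of_le (by linarith [pi_pos]),
        integral_tailKernel_mul_cos β hc hk, zero_mul]
    simp_rw [h0]
    simp
  · refine (hφ.comp_snd (volume.restrict (Ioc (-π) π))).bdd_mul
      (f := fun z : ℝ × ℝ => tailKernel α r β n (z.1 - z.2) * cos ((k : ℝ) * z.1 + d))
      (c := exp (-α * (n : ℝ) ^ r) * ∑' j, tailCoeff α r n j)
      (Continuous.aestronglyMeasurable (by fun_prop)) (.of_forall fun z => ?_)
    rw [norm_mul]
    exact (mul_le_of_le_one_right (norm_nonneg _) (abs_cos_le_one _)).trans (abs_tailKernel_le hc _)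

/-- The head of the kernel contributes a trigonometric polynomial of order `n - 1`, which
`fourierSum` reproduces; the tail contributes a function orthogonal to all frequencies below `n`,
which it annihilates. -/
lemma sub_fourierSum_eq (hn : 1 ≤ n) (hc : Summable (tailCoeff α r n))
    (hper : Function.Periodic φ (2 * π)) (hφ : Integrable φ circleMeasure) {f : ℝ → ℝ} {a₀ : ℝ}
    (hf : ∀ x, f x = a₀ / 2 + 1 / π * ∫ t in (-π)..π, poissonKernel α r β (x - t) * φ t) (x : ℝ) :
    f x - fourierSum (n - 1) f x = 1 / π * tailConvolution α r β n φ x := by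
  set A : ℕ → ℝ := fun k => 1 / π *
    (exp (-α * (k : ℝ) ^ r) * ∫ t, cos ((k : ℝ) * t + β * π / 2) * φ t ∂circleMeasure) with hA
  set B : ℕ → ℝ := fun k => 1 / π *
    (exp (-α * (k : ℝ) ^ r) * ∫ t, sin ((k : ℝ) * t + β * π / 2) * φ t ∂circleMeasure) with hB
  have hi : ∀ k : ℕ, Integrable (fun t => cos ((k : ℝ) * t + β * π / 2) * φ t) circleMeasure :=
    fun k => hφ.bdd_mul (c := 1) (Continuous.aestronglyMeasurable (by fun_prop))
      (.of_forall fun t => abs_cos_le_one _)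
  have hi' : ∀ k : ℕ, Integrable (fun t => sin ((k : ℝ) * t + β * π / 2) * φ t) circleMeasure :=
    fun k => hφ.bdd_mul (c := 1) (Continuous.aestronglyMeasurable (by fun_prop))
      (.of_forall fun t => abs_sin_le_one _)
  have hfe : f = fun y => trigPoly (n - 1) a₀ A B y + 1 / π * tailConvolution α r β n φ y := by
    ext y
    rw [hf, integral_circle_eq (fun t => by
      rw [hper t]
      have := (periodic_poissonKernel α r β).sub_eq (y - t)
      rw [show y - (t + 2 * π) = y - t - 2 * π by ring, this])]
    have e : ∀ t, poissonKernel α r β (y - t) * φ t =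
        ∑ k ∈ Finset.Icc 1 (n - 1), exp (-α * (k : ℝ) ^ r) *
          (cos ((k : ℝ) * y) * (cos ((k : ℝ) * t + β * π / 2) * φ t) +
            sin ((k : ℝ) * y) * (sin ((k : ℝ) * t + β * π / 2) * φ t)) +
          tailKernel α r β n (y - t) * φ t := by
      intro t
      rw [poissonKernel_eq_sum_add β hn hc, add_mul, Finset.sum_mul]
      congr 1
      refine Finset.sum_congr rfl fun k _ => ?_
      have : (k : ℝ) * (y - t) - β * π / 2 = k * y - (k * t + β * π / 2) := by ring
      rw [this, cos_sub]; ring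
    simp_rw [e]
    rw [integral_add _ (integrable_tailKernel_mul hc hφ y), integral_finsetSum]
    · rw [trigPoly, tailConvolution, mul_add, ← add_assoc, Finset.mul_sum]
      congr 2
      refine Finset.sum_congr rfl fun k _ => ?_
      rw [integral_const_mul, integral_add ((hi k).const_mul _) ((hi' k).const_mul _),
        integral_const_mul, integral_const_mul]
      simp only [hA, hB]
      ring
    · exact fun k _ => (((hi k).const_mul _).add ((hi' k).const_mul _)).const_mul _
    · exact integrable_finsetSum _
        fun k _ => (((hi k).const_mul _).add ((hi' k).const_mul _)).const_mul _
  have hR : Continuous fun y => 1 / π * tailConvolution α r β n φ y :=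
    continuous_const.mul (continuous_tailConvolution hc hφ)
  have := fourierSum_trigPoly_add (n - 1) a₀ A B hR (fun k hk d => by
    simp only [mul_assoc]
    rw [intervalIntegral.integral_const_mul,
      integral_tailConvolution_mul_cos hc hφ (by omega), mul_zero]) x
  rw [hfe, this]; ring

lemma integrable_of_mem_unitBall (hφ : φ ∈ unitBallZeroMean 1) : Integrable φ circleMeasure :=
  memLp_one_iff_integrable.1 hφ.2.1

lemma fourierDeviation_le {s : ℝ} (hs : 1 < s) (hn : 1 ≤ n) (hc : Summable (tailCoeff α r n)) :
    fourierDeviation α r β 1 (ENNReal.ofReal s) n ≤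
      ENNReal.ofReal (1 / π) * circleNorm s (tailKernel α r β n) := by
  refine iSup₂_le fun f hf => ?_
  obtain ⟨_, a₀, φ, hφ, hf⟩ := hf
  have hi := integrable_of_mem_unitBall hφ
  have h1 : circleNorm s (tailConvolution α r β n φ) ≤ circleNorm s (tailKernel α r β n) :=
    circleNorm_convolution_le hs (continuous_tailKernel β hc) (periodic_tailKernel β) hi.1 (by
      have := hφ.2.2.1
      rwa [periodNorm, eLpNorm_one_eq_lintegral_enorm] at this)
  have h2 := circleNorm_const_mul (s := s) (1 / π) (tailConvolution α r β n φ)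
  rw [abs_of_pos (by positivity)] at h2
  calc periodNorm (ENNReal.ofReal s) (fun x => f x - fourierSum (n - 1) f x)
      = circleNorm s (fun x => 1 / π * tailConvolution α r β n φ x) := by
        simp_rw [sub_fourierSum_eq hn hc hφ.1 hi hf]; rfl
    _ ≤ _ := by rw [h2]; gcongr

lemma circleNorm_tailConvolution_le_fourierDeviation {s : ℝ} (hn : 1 ≤ n)
    (hc : Summable (tailCoeff α r n)) (hφ : φ ∈ unitBallZeroMean 1) :
    circleNorm s (fun x => 1 / π * tailConvolution α r β n φ x) ≤
      fourierDeviation α r β 1 (ENNReal.ofReal s) n := by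
  have hi := integrable_of_mem_unitBall hφ
  set f : ℝ → ℝ := fun x => (0 : ℝ) / 2 + 1 / π * ∫ t in (-π)..π, poissonKernel α r β (x - t) * φ t
    with hf
  have hmem : f ∈ poissonClass α r β 1 := by
    refine ⟨fun x => ?_, 0, φ, hφ, fun x => rfl⟩
    simp only [hf]
    congr! 4 with t
    rw [show x + 2 * π - t = x - t + 2 * π by ring, periodic_poissonKernel]
  refine le_trans (le_of_eq ?_) (le_iSup₂ (f := fun f _ =>
    periodNorm (ENNReal.ofReal s) fun x => f x - fourierSum (n - 1) f x) f hmem)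
  simp_rw [sub_fourierSum_eq hn hc hφ.1 hi (fun x => rfl : ∀ x, f x = _)]
  rfl

end Deviation

/-! ### Dipoles and the lower bound -/

section Dipole

/-- The periodic difference of the normalized indicators of `[0, δ)` and `[h, h + δ)`. -/
def dipole (h δ t : ℝ) : ℝ :=
  1 / (2 * δ) * ((Ico 0 δ).indicator 1 (toIcoMod two_pi_pos 0 t) -
    (Ico h (h + δ)).indicator 1 (toIcoMod two_pi_pos 0 t))

variable {h δ : ℝ}

lemma dipole_eq {t : ℝ} (ht : t ∈ Ico 0 (2 * π)) :
    dipole h δ t = 1 / (2 * δ) * ((Ico 0 δ).indicator 1 t - (Ico h (h + δ)).indicator 1 t) := by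
  rw [dipole, (toIcoMod_eq_self two_pi_pos).2 (by simpa using ht)]

lemma integral_mul_dipole (hδ : 0 < δ) (hh : 0 ≤ h) (hd : h + δ ≤ 2 * π) {g : ℝ → ℝ}
    (hg : Continuous g) :
    ∫ t, g t * dipole h δ t ∂circleMeasure =
      1 / (2 * δ) * ((∫ t in (0 : ℝ)..δ, g t) - ∫ t in h..(h + δ), g t) := by
  have key : ∀ c, 0 ≤ c → c + δ ≤ 2 * π →
      Integrable ((Ico c (c + δ)).indicator g) circleMeasure ∧
      ∫ t, (Ico c (c + δ)).indicator g t ∂circleMeasure = ∫ t in c..(c + δ), g t := by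
    intro c hc hcd
    constructor
    · exact (integrable_indicator_iff measurableSet_Ico).2 ((hg.integrableOn_Icc.mono_set
        Ico_subset_Icc_self).mono_measure Measure.restrict_le_self)
    · rw [integral_indicator measurableSet_Ico, circleMeasure,
        Measure.restrict_restrict measurableSet_Ico,
        inter_eq_left.2 (Ico_subset_Ico hc hcd), intervalIntegral.integral_of_le (by linarith),
        integral_Ico_eq_integral_Ioo, integral_Ioc_eq_integral_Ioo]
  have h0 := key 0 le_rfl (by linarith)
  have h1 := key h hh hd
  rw [zero_add] at h0
  rw [← h0.2, ← h1.2, ← integral_sub h0.1 h1.1, ← integral_const_mul]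
  refine setIntegral_congr_fun measurableSet_Ico fun t ht => ?_
  simp only [dipole_eq ht]
  have e : ∀ S : Set ℝ, S.indicator g t = g t * S.indicator 1 t := by
    intro S
    by_cases hS : t ∈ S <;> simp [hS]
  rw [e, e]; ring

/-- Each bump has mass `1/2`, so the norm is at most one even if the bumps overlap, and the signed
masses cancel. -/
lemma dipole_mem_unitBallZeroMean (hδ : 0 < δ) (hh : 0 ≤ h) (hd : h + δ ≤ 2 * π) :
    dipole h δ ∈ unitBallZeroMean 1 := by
  have hm : Measurable fun t =>
      1 / (2 * δ) * ((Ico 0 δ).indicator 1 t - (Ico h (h + δ)).indicator 1 t) :=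
    ((measurable_one.indicator measurableSet_Ico).sub
      (measurable_one.indicator measurableSet_Ico)).const_mul _
  have hae : dipole h δ =ᵐ[circleMeasure] fun t =>
      1 / (2 * δ) * ((Ico 0 δ).indicator 1 t - (Ico h (h + δ)).indicator 1 t) :=
    (ae_restrict_iff' measurableSet_Ico).2 (.of_forall fun t ht => dipole_eq ht)
  have hnorm : periodNorm 1 (dipole h δ) ≤ 1 := by
    rw [periodNorm, eLpNorm_one_eq_lintegral_enorm]
    have hle : ∀ t ∈ Ico 0 (2 * π), ‖dipole h δ t‖ₑ ≤ ENNReal.ofReal (1 / (2 * δ)) *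
        ((Ico 0 δ).indicator 1 t + (Ico h (h + δ)).indicator 1 t) := by
      intro t ht
      rw [dipole_eq ht, enorm_mul, enorm_eq_ofReal (by positivity)]
      gcongr
      refine (enorm_sub_le).trans (add_le_add ?_ ?_) <;>
      · rw [enorm_indicator_eq_indicator_enorm]
        refine le_of_eq ?_
        congr 1; ext; simp
    refine (setLIntegral_mono' measurableSet_Ico hle).trans ?_
    rw [lintegral_const_mul' _ _ ENNReal.ofReal_ne_top, lintegral_add_left
      (measurable_one.indicator measurableSet_Ico), lintegral_indicator_one measurableSet_Ico,
      lintegral_indicator_one measurableSet_Ico]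
    have e1 : circleMeasure (Ico 0 δ) ≤ ENNReal.ofReal δ := by
      refine (Measure.restrict_apply_le _ _).trans ?_
      simp
    have e2 : circleMeasure (Ico h (h + δ)) ≤ ENNReal.ofReal δ := by
      refine (Measure.restrict_apply_le _ _).trans ?_
      simp
    calc _ ≤ ENNReal.ofReal (1 / (2 * δ)) * (ENNReal.ofReal δ + ENNReal.ofReal δ) := by gcongr
      _ = 1 := by
        rw [← ENNReal.ofReal_add hδ.le hδ.le, ← ENNReal.ofReal_mul (by positivity),
          ← ENNReal.ofReal_one]
        congr 1; field_simp; norm_num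
  refine ⟨fun t => by unfold dipole; rw [toIcoMod_periodic two_pi_pos 0 t],
    ⟨(hm.aestronglyMeasurable).congr hae.symm, hnorm.trans_lt ENNReal.one_lt_top⟩, hnorm, ?_⟩
  have := integral_mul_dipole hδ hh hd (g := fun _ => (1 : ℝ)) continuous_const
  simp only [one_mul, intervalIntegral.integral_const, sub_zero, add_sub_cancel_left, sub_self,
    mul_zero] at this
  rw [intervalIntegral.integral_of_le two_pi_pos.le, integral_Ioc_eq_integral_Ioo,
    ← integral_Ico_eq_integral_Ioo]
  exact this

lemma tendsto_average {g : ℝ → ℝ} (hg : Continuous g) (c : ℝ) :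
    Filter.Tendsto (fun δ => δ⁻¹ * ∫ t in c..(c + δ), g t) (nhdsWithin 0 (Ioi 0)) (nhds (g c)) := by
  have h := (intervalIntegral.integral_hasDerivAt_right (hg.intervalIntegrable c c)
    (hg.stronglyMeasurableAtFilter _ _) hg.continuousAt).tendsto_slope_zero_right
  simpa using h

lemma tendsto_integral_mul_dipole (hh : 0 ≤ h) (h2 : h < 2 * π) {g : ℝ → ℝ} (hg : Continuous g) :
    Filter.Tendsto (fun δ => ∫ t, g t * dipole h δ t ∂circleMeasure) (nhdsWithin 0 (Ioi 0))
      (nhds ((g 0 - g h) / 2)) := by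
  have h1 := ((tendsto_average hg 0).sub (tendsto_average hg h)).div_const 2
  refine h1.congr' ?_
  filter_upwards [Ioo_mem_nhdsGT (show (0 : ℝ) < 2 * π - h by linarith)] with δ hδ
  rw [integral_mul_dipole hδ.1 hh (by linarith [hδ.2]) hg, zero_add]
  have := hδ.1.ne'
  field_simp

end Dipole

/-- As the dipole shrinks, its convolution with the tail converges pointwise to half the difference
of two translates. Fatou's lemma carries the uniform bound to the limit. -/
lemma circleNorm_sub_shift_le_fourierDeviation {α r β s h : ℝ} {n : ℕ} (hn : 1 ≤ n)
    (hc : Summable (tailCoeff α r n)) (hh : 0 ≤ h) (h2 : h < 2 * π) :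
    circleNorm s (fun x => 1 / (2 * π) * (tailKernel α r β n x - tailKernel α r β n (x - h))) ≤
      fourierDeviation α r β 1 (ENNReal.ofReal s) n := by
  obtain ⟨u, hu⟩ := Filter.exists_seq_tendsto (nhdsWithin (0 : ℝ) (Ioi 0))
  have hu0 : ∀ᶠ m in Filter.atTop, u m ∈ Ioo 0 (2 * π - h) :=
    hu (Ioo_mem_nhdsGT (show (0 : ℝ) < 2 * π - h by linarith))
  obtain ⟨N, hN⟩ := Filter.eventually_atTop.1 hu0
  -- Reindexing makes every term, not just almost every one, an admissible width.
  set v : ℕ → ℝ := fun m => u (m + N) with hv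
  have hv0 : ∀ m, v m ∈ Ioo 0 (2 * π - h) := fun m => hN _ (Nat.le_add_left N m)
  have hvt : Filter.Tendsto v Filter.atTop (nhdsWithin 0 (Ioi 0)) :=
    hu.comp (Filter.tendsto_add_atTop_nat N)
  have hT := continuous_tailKernel β hc
  have hmem : ∀ m, dipole h (v m) ∈ unitBallZeroMean 1 := fun m =>
    dipole_mem_unitBallZeroMean (hv0 m).1 hh (by linarith [(hv0 m).2])
  refine (Lp.eLpNorm_lim_le_liminf_eLpNorm
    (f := fun m x => 1 / π * tailConvolution α r β n (dipole h (v m)) x)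
    (fun m => (continuous_const.mul (continuous_tailConvolution hc
      (integrable_of_mem_unitBall (hmem m)))).aestronglyMeasurable) _
    (.of_forall fun x => ?_)).trans ?_
  · have h1 := ((tendsto_integral_mul_dipole hh h2
      (g := fun t => tailKernel α r β n (x - t)) (by fun_prop)).comp hvt).const_mul (1 / π)
    simp only [sub_zero] at h1
    have e : 1 / (2 * π) * (tailKernel α r β n x - tailKernel α r β n (x - h)) =
        1 / π * ((tailKernel α r β n x - tailKernel α r β n (x - h)) / 2) := by ring
    rw [e]
    exact h1
  · refine Filter.liminf_le_of_le (by isBoundedDefault) fun b hb => ?_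
    obtain ⟨m, hm⟩ := hb.exists
    exact hm.trans (circleNorm_tailConvolution_le_fourierDeviation hn hc (hmem m))

/-! ### Consequences of the threshold -/

section Threshold

lemma nZeroBound_ofReal {q : ℝ} (hq : 1 < q) :
    nZeroBound (ENNReal.ofReal q) = 1 / (3 * π) ^ 3 * ((q - 1) / q) := by
  unfold nZeroBound
  rw [if_neg, if_neg ENNReal.ofReal_ne_top, ENNReal.toReal_ofReal (by linarith)]
  rw [ENNReal.ofReal_eq_one]
  exact hq.ne'

lemma chi_ofReal {q : ℝ} (hq : 1 < q) : chi (ENNReal.ofReal q) = q := by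
  unfold chi
  rw [if_neg ENNReal.ofReal_ne_top, ENNReal.toReal_ofReal (by linarith)]

lemma nZeroBound_ofReal_le {q : ℝ} (hq : 1 < q) : nZeroBound (ENNReal.ofReal q) ≤ 1 / 4 := by
  rw [nZeroBound_ofReal hq]
  have h1 : (q - 1) / q ≤ 1 := (div_le_one (by linarith)).2 (by linarith)
  have h0 : 0 ≤ (q - 1) / q := div_nonneg (by linarith) (by linarith)
  have h3 : (3 * 3 : ℝ) ^ 3 ≤ (3 * π) ^ 3 := by gcongr; exact pi_gt_three.le
  have h2 : 1 / (3 * π) ^ 3 ≤ 1 / 4 := one_div_le_one_div_of_le (by norm_num) (by linarith)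
  calc _ ≤ 1 / 4 * (1 : ℝ) := by gcongr
    _ = 1 / 4 := by ring

/-- Both terms tend to zero, so the defining set is nonempty. This is needed because `sInf ∅ = 0` in
`ℕ`. -/
lemma nZero_mem {α r q : ℝ} (hr0 : 0 < r) (hr1 : r < 1) (hq : 1 < q) :
    1 ≤ nZero α r (ENNReal.ofReal q) ∧
      1 / (α * r) * (1 / (nZero α r (ENNReal.ofReal q) : ℝ) ^ r) +
        α * r * q / (nZero α r (ENNReal.ofReal q) : ℝ) ^ (1 - r) ≤ nZeroBound (ENNReal.ofReal q) := by
  have hpos : 0 < nZeroBound (ENNReal.ofReal q) := by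
    rw [nZeroBound_ofReal hq]
    have : 0 < (q - 1) / q := div_pos (by linarith) (by linarith)
    positivity
  have ht : Filter.Tendsto (fun n : ℕ => 1 / (α * r) * (1 / (n : ℝ) ^ r) +
      α * r * q / (n : ℝ) ^ (1 - r)) Filter.atTop (nhds 0) := by
    have h1 := ((tendsto_rpow_neg_atTop hr0).comp tendsto_natCast_atTop_atTop).const_mul (1 / (α * r))
    have h2 := ((tendsto_rpow_neg_atTop (y := 1 - r) (by linarith)).comp
      tendsto_natCast_atTop_atTop).const_mul (α * r * q)
    have h3 := h1.add h2
    rw [mul_zero, mul_zero, add_zero] at h3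
    refine h3.congr fun n => ?_
    simp only [Function.comp_apply]
    rw [rpow_neg n.cast_nonneg, rpow_neg n.cast_nonneg]
    simp only [div_eq_mul_inv, one_mul]
  have hne : {n : ℕ | 1 ≤ n ∧ 1 / (α * r) * (1 / (n : ℝ) ^ r) +
      α * r * chi (ENNReal.ofReal q) / (n : ℝ) ^ (1 - r) ≤ nZeroBound (ENNReal.ofReal q)}.Nonempty := by
    obtain ⟨n, hn1, hn2⟩ := ((Filter.eventually_ge_atTop 1).and
      (ht.eventually_lt_const hpos)).exists
    exact ⟨n, hn1, by rw [chi_ofReal hq]; exact hn2.le⟩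
  have h := Nat.sInf_mem hne
  change 1 ≤ nZero α r (ENNReal.ofReal q) ∧
    1 / (α * r) * (1 / (nZero α r (ENNReal.ofReal q) : ℝ) ^ r) +
      α * r * chi (ENNReal.ofReal q) / (nZero α r (ENNReal.ofReal q) : ℝ) ^ (1 - r) ≤ _ at h
  rwa [chi_ofReal hq] at h

/-- The bound `1/4` on the first term gives `α r m^r ≥ 4` at the threshold `m`, and on the second it
gives a small slope. Both properties persist for larger `n` by monotonicity. -/
lemma slope_bounds_of_nZero_le {α r q : ℝ} {n : ℕ} (hα : 0 < α) (hr0 : 0 < r) (hr1 : r < 1)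
    (hq : 1 < q) (hn : nZero α r (ENNReal.ofReal q) ≤ n) :
    1 ≤ n ∧ 2 ≤ n * slope α r n ∧ slope α r n ≤ 1 := by
  obtain ⟨hm1, hm2⟩ := nZero_mem (α := α) hr0 hr1 hq
  set m := nZero α r (ENNReal.ofReal q)
  have hb := hm2.trans (nZeroBound_ofReal_le hq)
  have hm0 : (0 : ℝ) < m := by exact_mod_cast hm1
  have hmn : (m : ℝ) ≤ n := by exact_mod_cast hn
  have hn0 := hm0.trans_le hmn
  have hαr : 0 < α * r := mul_pos hα hr0
  have t1 : 0 ≤ 1 / (α * r) * (1 / (m : ℝ) ^ r) := by positivity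
  have t2 : 0 ≤ α * r * q / (m : ℝ) ^ (1 - r) := by positivity
  refine ⟨hm1.trans hn, ?_, ?_⟩
  · have h1 : (n : ℝ) * slope α r n = α * r * n ^ r := by
      rw [slope, rpow_sub_one hn0.ne']; field_simp
    have h2 : (m : ℝ) ^ r ≤ n ^ r := rpow_le_rpow hm0.le hmn hr0.le
    have h3 : 1 / (α * r) * (1 / (m : ℝ) ^ r) ≤ 1 / 4 := by linarith
    have h5 : 0 < α * r * (m : ℝ) ^ r := by positivity
    have h4 : 4 ≤ α * r * (m : ℝ) ^ r := by
      have : 1 / (α * r * (m : ℝ) ^ r) ≤ 1 / 4 := by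
        refine le_trans (le_of_eq ?_) h3
        field_simp
      exact (one_div_le_one_div h5 (by norm_num)).1 this
    rw [h1]
    have := mul_le_mul_of_nonneg_left h2 hαr.le
    linarith
  · have h1 : slope α r n = α * r / (n : ℝ) ^ (1 - r) := by
      rw [slope, ← neg_sub, rpow_neg hn0.le, div_eq_mul_inv]
    have h2 : α * r / (n : ℝ) ^ (1 - r) ≤ α * r * q / (m : ℝ) ^ (1 - r) := by
      have : (m : ℝ) ^ (1 - r) ≤ n ^ (1 - r) := rpow_le_rpow hm0.le hmn (by linarith)
      have h3 : α * r ≤ α * r * q := le_mul_of_one_le_right hαr.le hq.le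
      gcongr
    rw [h1]; linarith

end Threshold

/-! ### Norms of the pole kernel on a period and on the line -/

section Pole

variable {s a : ℝ}

/-- The `L_s`-norm of the pole kernel over `[-π, π]`. -/
def poleNorm (s a : ℝ) : ℝ := (∫ t in (-π)..π, ‖poleKernel a t‖ ^ s) ^ (1 / s)

lemma poleNorm_nonneg (s a : ℝ) : 0 ≤ poleNorm s a :=
  rpow_nonneg (intervalIntegral.integral_nonneg (by linarith [pi_pos])
    fun t _ => rpow_nonneg (norm_nonneg _) _) _

lemma eLpNorm_poleKernel (hs : 1 < s) (ha : 0 < a) :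
    eLpNorm (poleKernel a) (ENNReal.ofReal s) (volume.restrict (Ioc (-π) π)) =
      ENNReal.ofReal (poleNorm s a) := by
  have hc := continuous_poleKernel ha
  obtain ⟨C, hC⟩ := (isCompact_Icc (a := -π) (b := π)).exists_bound_of_continuousOn hc.continuousOn
  have hm : MemLp (poleKernel a) (ENNReal.ofReal s) (volume.restrict (Ioc (-π) π)) :=
    MemLp.of_bound (C := C) hc.aestronglyMeasurable ((ae_restrict_iff' measurableSet_Ioc).2
      (.of_forall fun x hx => hC x (Ioc_subset_Icc_self hx)))
  rw [hm.eLpNorm_eq_integral_rpow_norm (by simp; linarith) ENNReal.ofReal_ne_top,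
    ENNReal.toReal_ofReal (by linarith), poleNorm,
    intervalIntegral.integral_of_le (by linarith [pi_pos]), one_div]

lemma eLpNorm_const_Ioc_le {c : ℝ} (hs : 1 < s) (hc : 0 ≤ c) :
    eLpNorm (fun _ : ℝ => c) (ENNReal.ofReal s) (volume.restrict (Ioc (-π) π)) ≤
      ENNReal.ofReal (2 * π * c) := by
  have h := circleNorm_eq_Ioc hs (f := fun _ : ℝ => c) fun _ => rfl
  rw [← h]
  exact circleNorm_const_le hs fun _ => (norm_of_nonneg hc).le

lemma circleNorm_le_of_norm_le {f : ℝ → ℂ} (hs : 1 < s) (ha : 0 < a)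
    (hp : Function.Periodic f (2 * π)) {c d : ℝ} (hc : 0 ≤ c) (hd : 0 ≤ d)
    (h : ∀ t, |t| ≤ π → ‖f t‖ ≤ c + d * ‖poleKernel a t‖) :
    circleNorm s f ≤ ENNReal.ofReal (2 * π * c + d * poleNorm s a) := by
  have hK := continuous_poleKernel ha
  rw [circleNorm_eq_Ioc hs hp]
  have h1 : eLpNorm f (ENNReal.ofReal s) (volume.restrict (Ioc (-π) π)) ≤
      eLpNorm ((fun _ : ℝ => c) + fun t => d • ‖poleKernel a t‖) (ENNReal.ofReal s)
        (volume.restrict (Ioc (-π) π)) := by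
    refine eLpNorm_mono_ae ((ae_restrict_iff' measurableSet_Ioc).2 (.of_forall fun t ht => ?_))
    exact (h t (abs_le.2 ⟨ht.1.le, ht.2⟩)).trans (le_abs_self _)
  refine h1.trans ((eLpNorm_add_le aestronglyMeasurable_const
    (Continuous.aestronglyMeasurable (by fun_prop)) (by simpa using hs.le)).trans ?_)
  rw [ENNReal.ofReal_add (by positivity) (mul_nonneg hd (poleNorm_nonneg _ _))]
  refine add_le_add (eLpNorm_const_Ioc_le hs hc) (le_of_eq ?_)
  have h2 := eLpNorm_const_smul d (fun t => ‖poleKernel a t‖) (ENNReal.ofReal s)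
    (volume.restrict (Ioc (-π) π))
  rw [eLpNorm_norm, eLpNorm_poleKernel hs ha, enorm_eq_ofReal hd, ← ENNReal.ofReal_mul hd] at h2
  exact h2

lemma poleNorm_le_add {f : ℝ → ℂ} (hs : 1 < s) (ha : 0 < a) (hf : Continuous f)
    (hp : Function.Periodic f (2 * π)) {c : ℝ} (hc : 0 ≤ c)
    (h : ∀ t, |t| ≤ π → ‖f t - poleKernel a t‖ ≤ c) :
    ENNReal.ofReal (poleNorm s a) ≤ circleNorm s f + ENNReal.ofReal (2 * π * c) := by
  rw [circleNorm_eq_Ioc hs hp, ← eLpNorm_poleKernel hs ha]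
  have h1 : eLpNorm (poleKernel a) (ENNReal.ofReal s) (volume.restrict (Ioc (-π) π)) ≤
      eLpNorm ((fun t => ‖f t‖) + fun _ : ℝ => c) (ENNReal.ofReal s)
        (volume.restrict (Ioc (-π) π)) := by
    refine eLpNorm_mono_ae ((ae_restrict_iff' measurableSet_Ioc).2 (.of_forall fun t ht => ?_))
    have h2 := h t (abs_le.2 ⟨ht.1.le, ht.2⟩)
    have h3 := norm_sub_norm_le (poleKernel a t) (f t)
    rw [norm_sub_rev] at h3
    refine le_trans ?_ (le_abs_self _)
    simp only [Pi.add_apply]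
    linarith
  refine h1.trans ((eLpNorm_add_le (Continuous.aestronglyMeasurable (by fun_prop))
    aestronglyMeasurable_const (by simpa using hs.le)).trans ?_)
  rw [eLpNorm_norm]
  gcongr
  exact eLpNorm_const_Ioc_le hs hc

/-- The `L_s`-norm of the pole kernel over the line. -/
def fullPoleNorm (s a : ℝ) : ℝ := (2 * a ^ (1 - s) * poleIntegral s) ^ (1 / s)

lemma poleNorm_le_fullPoleNorm (hs : 1 < s) (ha : 0 < a) : poleNorm s a ≤ fullPoleNorm s a := by
  have hpa : 0 ≤ π / a := by positivity
  have h1 : 0 ≤ ∫ x in Ioi (π / a), (1 + x ^ 2) ^ (-(s / 2)) :=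
    integral_nonneg fun x => rpow_nonneg (one_add_sq_pos x).le _
  have h2 : 0 ≤ ∫ x in (0 : ℝ)..(π / a), (1 + x ^ 2) ^ (-(s / 2)) :=
    intervalIntegral.integral_nonneg hpa fun x _ => rpow_nonneg (one_add_sq_pos x).le _
  rw [poleNorm, integral_norm_poleKernel_rpow ha, fullPoleNorm, poleIntegral_eq_add hs hpa]
  gcongr
  linarith

lemma two_rpow_one_div_le (hs : 1 < s) : (2 : ℝ) ^ (1 / s) ≤ 2 := by
  calc (2 : ℝ) ^ (1 / s) ≤ 2 ^ (1 : ℝ) :=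
        rpow_le_rpow_of_exponent_le one_le_two ((div_le_one (by linarith)).2 hs.le)
    _ = 2 := rpow_one 2

lemma fullPoleNorm_eq (hs : 1 < s) (ha : 0 < a) :
    fullPoleNorm s a = 2 ^ (1 / s) * a ^ (-(1 - 1 / s)) * poleIntegral s ^ (1 / s) := by
  have hI := poleIntegral_pos hs
  rw [fullPoleNorm, mul_rpow (by positivity) hI.le, mul_rpow zero_le_two (by positivity),
    ← rpow_mul ha.le]
  congr 3
  have : s ≠ 0 := by linarith
  field_simp; ring

lemma fullPoleNorm_le (hs : 1 < s) (ha : 0 < a) :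
    fullPoleNorm s a ≤ 2 * (a ^ (-(1 - 1 / s)) * (s / (s - 1)) ^ (1 / s)) := by
  have hI := poleIntegral_pos hs
  rw [fullPoleNorm_eq hs ha, mul_assoc]
  have := two_rpow_one_div_le hs
  have := poleIntegral_le hs
  have hs0 : 0 < s := by linarith
  gcongr

lemma rpow_sub_le_of_le {X δ p : ℝ} (hX : 0 < X) (hδX : δ ≤ X) (hδ : 0 ≤ δ) (hp0 : 0 ≤ p)
    (hp1 : p ≤ 1) : X ^ p - (X - δ) ^ p ≤ δ * X ^ (p - 1) := by
  have hy0 : 0 ≤ 1 - δ / X := sub_nonneg.2 ((div_le_one hX).2 hδX)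
  have hy1 : 1 - δ / X ≤ 1 := by have : 0 ≤ δ / X := by positivity
                                 linarith
  have h1 : (1 - δ / X) ^ (1 : ℝ) ≤ (1 - δ / X) ^ p :=
    rpow_le_rpow_of_exponent_ge' hy0 hy1 hp0 hp1
  have h2 : X - δ = X * (1 - δ / X) := by field_simp
  rw [rpow_one] at h1
  rw [h2, mul_rpow hX.le hy0, rpow_sub_one hX.ne']
  have h3 : 0 < X ^ p := rpow_pos_of_pos hX p
  have := mul_le_mul_of_nonneg_left h1 h3.le
  have e : X ^ p * (1 - δ / X) = X ^ p - δ * (X ^ p / X) := by ring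
  linarith

/-- Cutting the line to one period loses `δ ≤ 2/(s-1)` in the `s`-th power. How this affects the
`s`-th root depends on whether `s ≤ 2`. -/
lemma fullPoleNorm_le_poleNorm_add (hs : 1 < s) (ha : 0 < a) :
    fullPoleNorm s a ≤ poleNorm s a + (2 + 2 * (a ^ ((s - 1) * (1 - 1 / s)) / (s - 1))) := by
  have hpa : 0 < π / a := by positivity
  have hs0 : 0 < s := by linarith
  have hs1 : 0 < s - 1 := by linarith
  have h1 : 0 ≤ ∫ x in Ioi (π / a), (1 + x ^ 2) ^ (-(s / 2)) :=
    integral_nonneg fun x => rpow_nonneg (one_add_sq_pos x).le _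
  have h2 : 0 ≤ ∫ x in (0 : ℝ)..(π / a), (1 + x ^ 2) ^ (-(s / 2)) :=
    intervalIntegral.integral_nonneg hpa.le fun x _ => rpow_nonneg (one_add_sq_pos x).le _
  have h3 := setIntegral_Ioi_one_add_sq_le hs hpa
  have h4 := poleIntegral_eq_add hs hpa.le
  rw [poleNorm, integral_norm_poleKernel_rpow ha, fullPoleNorm]
  set J := ∫ x in (0 : ℝ)..(π / a), (1 + x ^ 2) ^ (-(s / 2))
  set R := ∫ x in Ioi (π / a), (1 + x ^ 2) ^ (-(s / 2))
  have hA : 0 < a ^ (1 - s) := rpow_pos_of_pos ha _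
  set δ := 2 * a ^ (1 - s) * R with hδ
  have hδ0 : 0 ≤ δ := by positivity
  have hδ1 : δ ≤ 2 / (s - 1) := by
    have e1 : a ^ (1 - s) * (π / a) ^ (1 - s) ≤ 1 := by
      rw [← mul_rpow ha.le hpa.le, mul_div_cancel₀ _ ha.ne']
      exact rpow_le_one_of_one_le_of_nonpos (by linarith [pi_gt_three]) (by linarith)
    calc δ ≤ 2 * a ^ (1 - s) * ((π / a) ^ (1 - s) / (s - 1)) := by rw [hδ]; gcongr
      _ = 2 * (a ^ (1 - s) * (π / a) ^ (1 - s)) / (s - 1) := by ring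
      _ ≤ 2 * 1 / (s - 1) := by gcongr
      _ = _ := by ring
  have hp0 : 0 ≤ 1 / s := by positivity
  have hp1 : 1 / s ≤ 1 := (div_le_one hs0).2 hs.le
  have hlast : 0 ≤ a ^ ((s - 1) * (1 - 1 / s)) / (s - 1) := by positivity
  rcases le_total s 2 with h | h
  -- For `s` near `1` the loss `δ` may be huge, but it is multiplied by the derivative scale
  -- `X^{1/s-1}`, which is small since `X ≥ a^{1-s}`.
  · have hI := half_le_poleIntegral hs h
    set X := 2 * a ^ (1 - s) * poleIntegral s with hX
    have hXA : a ^ (1 - s) ≤ X := by rw [hX]; nlinarith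
    have hX0 : 0 < X := hA.trans_le hXA
    have hXJ : 2 * a ^ (1 - s) * J = X - δ := by rw [hX, hδ, h4]; ring
    have hJ : 0 ≤ 2 * a ^ (1 - s) * J := by positivity
    have h5 := rpow_sub_le_of_le hX0 (by linarith) hδ0 hp0 hp1
    have h6 : X ^ (1 / s - 1) ≤ a ^ ((s - 1) * (1 - 1 / s)) := by
      calc X ^ (1 / s - 1) ≤ (a ^ (1 - s)) ^ (1 / s - 1) :=
            rpow_le_rpow_of_nonpos hA hXA (by linarith)
        _ = _ := by rw [← rpow_mul ha.le]; congr 1; ring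
    have h7 : δ * X ^ (1 / s - 1) ≤ 2 / (s - 1) * a ^ ((s - 1) * (1 - 1 / s)) := by gcongr
    rw [hXJ]
    have e : 2 / (s - 1) * a ^ ((s - 1) * (1 - 1 / s)) =
      2 * (a ^ ((s - 1) * (1 - 1 / s)) / (s - 1)) := by ring
    linarith
  -- For `s ≥ 2` one has `δ ≤ 2`, and subadditivity of the root suffices.
  · have hJ : 0 ≤ 2 * a ^ (1 - s) * J := by positivity
    have h5 := rpow_add_le_add_rpow hJ hδ0 hp0 hp1
    have h6 : δ ^ (1 / s) ≤ 2 := by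
      refine le_trans (rpow_le_rpow hδ0 (hδ1.trans ?_) hp0) (two_rpow_one_div_le hs)
      rw [div_le_iff₀ hs1]; linarith
    have e : 2 * a ^ (1 - s) * poleIntegral s = 2 * a ^ (1 - s) * J + δ := by rw [h4, hδ]; ring
    rw [e]
    linarith

end Pole

/-! ### The norm of the slowly varying factor -/

section Kernel

variable {α r s : ℝ} {n : ℕ}

lemma periodic_geomKernel (a : ℝ) : Function.Periodic (geomKernel a) (2 * π) := by
  intro t
  unfold geomKernel
  push_cast
  rw [add_mul, Complex.exp_add, Complex.exp_two_pi_mul_I, mul_one]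

lemma continuous_geomKernel {a : ℝ} (ha : 0 < a) : Continuous (geomKernel a) := by
  have h := continuous_trigSeries (summable_exp_neg_pow ha)
  rwa [show trigSeries (fun j => exp (-a) ^ j) = geomKernel a from
    funext (trigSeries_exp_neg_pow ha)] at h

lemma trigSeries_tailCoeff_eq (hα : 0 < α) (hr0 : 0 < r) (hn : 1 ≤ n)
    (hk : 2 ≤ n * slope α r n) (t : ℝ) :
    trigSeries (tailCoeff α r n) t =
      trigSeries (coeffGap α r n) t + geomKernel (slope α r n) t := by
  have ha := slope_pos hα hr0 hn
  have h := trigSeries_sub (summable_tailCoeff hα hn hk) (summable_exp_neg_pow ha) t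
  rw [trigSeries_exp_neg_pow ha] at h
  change trigSeries (coeffGap α r n) t = _ at h
  rw [h]; ring

/-- The bound for the norm of `trigSeries (coeffGap α r n)`. -/
def gapBound (α r s : ℝ) (n : ℕ) : ℝ :=
  10 * π + 10 / (n * slope α r n) * poleNorm s (slope α r n)

/-- The bound for the norm of the increments of `trigSeries (tailCoeff α r n)`. -/
def shiftBound (α r s : ℝ) (n : ℕ) : ℝ :=
  2 * gapBound α r s n + 8 * π ^ 2 / (n * slope α r n) * poleNorm s (slope α r n)

lemma gapBound_nonneg (hα : 0 < α) (hr0 : 0 < r) (hn : 1 ≤ n) : 0 ≤ gapBound α r s n := by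
  have ha := slope_pos hα hr0 hn
  have := poleNorm_nonneg s (slope α r n)
  unfold gapBound; positivity

lemma shiftBound_nonneg (hα : 0 < α) (hr0 : 0 < r) (hn : 1 ≤ n) : 0 ≤ shiftBound α r s n := by
  have ha := slope_pos hα hr0 hn
  have := poleNorm_nonneg s (slope α r n)
  have := gapBound_nonneg (s := s) hα hr0 hn
  unfold shiftBound; positivity

lemma circleNorm_coeffGap_le (hs : 1 < s) (hα : 0 < α) (hr0 : 0 < r) (hr1 : r < 1) (hn : 1 ≤ n)
    (hk : 2 ≤ n * slope α r n) :
    circleNorm s (trigSeries (coeffGap α r n)) ≤ ENNReal.ofReal (gapBound α r s n) := by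
  have ha := slope_pos hα hr0 hn
  refine (circleNorm_le_of_norm_le hs ha (periodic_trigSeries _) (c := 5)
    (d := 10 / (n * slope α r n)) (by norm_num) (by positivity)
    fun t ht => norm_trigSeries_coeffGap_le hα hr0 hr1 hn hk ht).trans (le_of_eq ?_)
  rw [gapBound]; congr 2; ring

lemma circleNorm_geomKernel_shift_le (hs : 1 < s) (hα : 0 < α) (hr0 : 0 < r) (hn : 1 ≤ n)
    (ha1 : slope α r n ≤ 1) {h : ℝ} (hh : |h| ≤ 2 * π / n) :
    circleNorm s (fun t => geomKernel (slope α r n) (t + h) - geomKernel (slope α r n) t) ≤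
      ENNReal.ofReal (8 * π ^ 2 / (n * slope α r n) * poleNorm s (slope α r n)) := by
  have ha := slope_pos hα hr0 hn
  have hp := periodic_geomKernel (slope α r n)
  refine (circleNorm_le_of_norm_le hs ha (fun t => by
      rw [hp t, show t + 2 * π + h = t + h + 2 * π by ring, hp (t + h)]) (c := 0)
    (d := 8 * π ^ 2 / (n * slope α r n)) le_rfl (by positivity) fun t ht => ?_).trans
    (le_of_eq (by rw [mul_zero, zero_add]))
  refine (norm_geomKernel_add_sub_le ha ha1 t h).trans ?_
  calc _ ≤ 2 * π / n * (2 / slope α r n) * (2 * π * ‖poleKernel (slope α r n) t‖) := by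
        gcongr
        exact norm_geomKernel_le ha ha1 ht
    _ = _ := by
      have : (n : ℝ) ≠ 0 := by positivity
      field_simp; ring

lemma circleNorm_tailCoeff_shift_le (hs : 1 < s) (hα : 0 < α) (hr0 : 0 < r) (hr1 : r < 1)
    (hn : 1 ≤ n) (hk : 2 ≤ n * slope α r n) (ha1 : slope α r n ≤ 1) {h : ℝ}
    (hh : |h| ≤ 2 * π / n) :
    circleNorm s (fun t => trigSeries (tailCoeff α r n) (t + h) - trigSeries (tailCoeff α r n) t) ≤
      ENNReal.ofReal (shiftBound α r s n) := by
  have ha := slope_pos hα hr0 hn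
  have hD := continuous_trigSeries (summable_coeffGap hα hr0 hn hk)
  have hB := continuous_geomKernel ha
  have e : ∀ t, trigSeries (tailCoeff α r n) (t + h) - trigSeries (tailCoeff α r n) t =
      (trigSeries (coeffGap α r n) (t + h) - trigSeries (coeffGap α r n) t) +
        (geomKernel (slope α r n) (t + h) - geomKernel (slope α r n) t) := by
    intro t
    rw [trigSeries_tailCoeff_eq hα hr0 hn hk, trigSeries_tailCoeff_eq hα hr0 hn hk]; ring
  simp_rw [e]
  have h0 := gapBound_nonneg (s := s) hα hr0 hn
  have hpn := poleNorm_nonneg s (slope α r n)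
  refine (circleNorm_add_le hs (by fun_prop) (by fun_prop)).trans ?_
  rw [shiftBound, ENNReal.ofReal_add (by positivity) (by positivity), two_mul,
    ENNReal.ofReal_add h0 h0]
  refine add_le_add ?_ (circleNorm_geomKernel_shift_le hs hα hr0 hn ha1 hh)
  refine (circleNorm_sub_le hs (by fun_prop) hD).trans ?_
  rw [circleNorm_comp_add hs hD (periodic_trigSeries _)]
  have := circleNorm_coeffGap_le hs hα hr0 hr1 hn hk
  exact add_le_add this this

/-- The constant `12π²` is the period length times the pointwise bound `6π` between the geometric
and pole kernels. -/
lemma circleNorm_tailCoeff_bounds (hs : 1 < s) (hα : 0 < α) (hr0 : 0 < r) (hr1 : r < 1)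
    (hn : 1 ≤ n) (hk : 2 ≤ n * slope α r n) (ha1 : slope α r n ≤ 1) :
    (circleNorm s (trigSeries (tailCoeff α r n))).toReal ≤
        poleNorm s (slope α r n) + (12 * π ^ 2 + gapBound α r s n) ∧
      poleNorm s (slope α r n) ≤
        (circleNorm s (trigSeries (tailCoeff α r n))).toReal + (12 * π ^ 2 + gapBound α r s n) := by
  have ha := slope_pos hα hr0 hn
  have hD := continuous_trigSeries (summable_coeffGap hα hr0 hn hk)
  have hG := continuous_trigSeries (summable_tailCoeff hα hn hk)
  have hB := continuous_geomKernel ha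
  have h0 := gapBound_nonneg (s := s) hα hr0 hn
  have hpn := poleNorm_nonneg s (slope α r n)
  have hDn := circleNorm_coeffGap_le hs hα hr0 hr1 hn hk
  have hB1 : circleNorm s (geomKernel (slope α r n)) ≤
      ENNReal.ofReal (poleNorm s (slope α r n) + 12 * π ^ 2) := by
    refine (circleNorm_le_of_norm_le hs ha (periodic_geomKernel _) (c := 6 * π) (d := 1)
      (by positivity) zero_le_one fun t ht => ?_).trans (le_of_eq (by congr 1; ring))
    have h1 := norm_geomKernel_sub_poleKernel_le ha ha1 ht
    have h2 := norm_sub_norm_le (geomKernel (slope α r n) t) (poleKernel (slope α r n) t)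
    linarith
  have hB2 := poleNorm_le_add hs ha hB (periodic_geomKernel _) (c := 6 * π) (by positivity)
    fun t ht => norm_geomKernel_sub_poleKernel_le ha ha1 ht
  have hGB : circleNorm s (trigSeries (tailCoeff α r n)) ≤
      circleNorm s (trigSeries (coeffGap α r n)) + circleNorm s (geomKernel (slope α r n)) := by
    rw [show trigSeries (tailCoeff α r n) = fun t => trigSeries (coeffGap α r n) t +
      geomKernel (slope α r n) t from funext (trigSeries_tailCoeff_eq hα hr0 hn hk)]
    exact circleNorm_add_le hs hD hB
  have hBG : circleNorm s (geomKernel (slope α r n)) ≤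
      circleNorm s (trigSeries (tailCoeff α r n)) + circleNorm s (trigSeries (coeffGap α r n)) := by
    rw [show geomKernel (slope α r n) = fun t => trigSeries (tailCoeff α r n) t -
      trigSeries (coeffGap α r n) t from funext fun t => by
        rw [trigSeries_tailCoeff_eq hα hr0 hn hk]; ring]
    exact circleNorm_sub_le hs hG hD
  constructor
  · refine ENNReal.toReal_le_of_le_ofReal (by positivity) (hGB.trans ((add_le_add hDn hB1).trans ?_))
    rw [← ENNReal.ofReal_add h0 (by positivity)]
    exact ENNReal.ofReal_le_ofReal (by linarith)
  · have h1 := hB2.trans (add_le_add (hBG.trans (add_le_add le_rfl hDn)) le_rfl)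
    rw [← ENNReal.ofReal_toReal (circleNorm_ne_top (s := s) hG),
      ← ENNReal.ofReal_add ENNReal.toReal_nonneg h0,
      ← ENNReal.ofReal_add (add_nonneg ENNReal.toReal_nonneg h0) (by positivity),
      ENNReal.ofReal_le_ofReal_iff (add_nonneg (add_nonneg ENNReal.toReal_nonneg h0)
        (by positivity))] at h1
    linarith

/-- The `s`-th mean `(1 / (2π) ∫ |cos|^s)^{1/s}` of the cosine. -/
def cosMean (s : ℝ) : ℝ := (circleNorm s cos).toReal / (2 * π) ^ (1 / s)

lemma cosMean_nonneg (s : ℝ) : 0 ≤ cosMean s := by unfold cosMean; positivity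

lemma cosMean_le_one (hs : 1 < s) : cosMean s ≤ 1 := by
  unfold cosMean
  rw [div_le_one (by positivity)]
  refine ENNReal.toReal_le_of_le_ofReal (by positivity) ?_
  have h : circleNorm s cos ≤ eLpNorm (fun _ : ℝ => (1 : ℝ)) (ENNReal.ofReal s) circleMeasure :=
    eLpNorm_mono fun x => by simpa using abs_cos_le_one x
  refine h.trans (le_of_eq ?_)
  rw [eLpNorm_const _ (by simp; linarith) (by
    rw [← Measure.measure_univ_ne_zero, circleMeasure_univ]; simp [pi_pos]),
    circleMeasure_univ, ENNReal.toReal_ofReal (by linarith),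
    ENNReal.ofReal_rpow_of_pos (by positivity)]
  simp

lemma abs_circleNorm_modulated_sub_le (hs : 1 < s) (hα : 0 < α) (hr0 : 0 < r) (hr1 : r < 1)
    (hn : 1 ≤ n) (hk : 2 ≤ n * slope α r n) (ha1 : slope α r n ≤ 1) (θ : ℝ) :
    |(circleNorm s (modulated n θ (trigSeries (tailCoeff α r n)))).toReal -
      cosMean s * (circleNorm s (trigSeries (tailCoeff α r n))).toReal| ≤ shiftBound α r s n := by
  have hG := continuous_trigSeries (summable_tailCoeff hα hn hk)
  obtain ⟨h1, h2⟩ := circleNorm_modulated_bounds hs hn hG (periodic_trigSeries _)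
    (fun h hh => circleNorm_tailCoeff_shift_le hs hα hr0 hr1 hn hk ha1 hh) θ
  have hN := circleNorm_ne_top (s := s) (continuous_modulated (n := n) θ hG)
  have hC := circleNorm_ne_top (s := s) continuous_cos
  have hG' := circleNorm_ne_top (s := s) hG
  have hL : ENNReal.ofReal (2 * π) ^ (1 / s) ≠ ∞ :=
    ENNReal.rpow_ne_top_of_nonneg (by positivity) ENNReal.ofReal_ne_top
  have h0 := shiftBound_nonneg (s := s) hα hr0 hn
  have g1 := ENNReal.toReal_mono (ENNReal.mul_ne_top hL
    (ENNReal.add_ne_top.2 ⟨hN, ENNReal.ofReal_ne_top⟩)) h1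
  have g2 := ENNReal.toReal_mono (ENNReal.add_ne_top.2 ⟨ENNReal.mul_ne_top hC hG',
    ENNReal.mul_ne_top hL ENNReal.ofReal_ne_top⟩) h2
  have hLr : (ENNReal.ofReal (2 * π) ^ (1 / s)).toReal = (2 * π) ^ (1 / s) := by
    rw [← ENNReal.toReal_rpow, ENNReal.toReal_ofReal two_pi_pos.le]
  rw [ENNReal.toReal_mul, ENNReal.toReal_mul, ENNReal.toReal_add hN ENNReal.ofReal_ne_top,
    ENNReal.toReal_ofReal h0, hLr] at g1
  rw [ENNReal.toReal_add (ENNReal.mul_ne_top hC hG')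
    (ENNReal.mul_ne_top hL ENNReal.ofReal_ne_top), ENNReal.toReal_mul, ENNReal.toReal_mul,
    ENNReal.toReal_mul, ENNReal.toReal_ofReal h0, hLr] at g2
  have hLp : 0 < (2 * π) ^ (1 / s) := by positivity
  unfold cosMean
  set N := (circleNorm s (modulated n θ (trigSeries (tailCoeff α r n)))).toReal
  set g := (circleNorm s (trigSeries (tailCoeff α r n))).toReal
  set C := (circleNorm s cos).toReal
  set L := (2 * π) ^ (1 / s)
  have e : C / L * g = C * g / L := by ring
  rw [e, abs_le]
  constructor
  · have : C * g / L ≤ N + shiftBound α r s n := by rw [div_le_iff₀ hLp]; linarith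
    linarith
  · have : N - shiftBound α r s n ≤ C * g / L := by rw [le_div_iff₀ hLp]; linarith
    linarith

end Kernel

/-! ### Two-sided estimate of the deviation -/

section Deviation

variable {α r s : ℝ} {n : ℕ} (β : ℝ)

lemma circleNorm_tailKernel :
    circleNorm s (tailKernel α r β n) = ENNReal.ofReal (exp (-α * (n : ℝ) ^ r)) *
      circleNorm s (modulated n (β * π / 2) (trigSeries (tailCoeff α r n))) := by
  have h := circleNorm_const_mul (s := s) (exp (-α * (n : ℝ) ^ r))
    (modulated n (β * π / 2) (trigSeries (tailCoeff α r n)))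
  rw [abs_exp] at h
  exact h

/-- The shift by `π/n` multiplies the carrier by `e^{-iπ} = -1`, so the sum contains only an
increment of the slow factor. -/
lemma tailKernel_add_shift (hn : 1 ≤ n) (t : ℝ) :
    tailKernel α r β n t + tailKernel α r β n (t - π / n) =
      exp (-α * (n : ℝ) ^ r) * modulated n (β * π / 2) (fun x =>
        trigSeries (tailCoeff α r n) x - trigSeries (tailCoeff α r n) (x - π / n)) t := by
  have hn' : (n : ℝ) ≠ 0 := by positivity
  unfold tailKernel modulated
  have e : ((n * (t - π / n) - β * π / 2 : ℝ) : ℂ) * Complex.I =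
      (n * t - β * π / 2 : ℝ) * Complex.I - π * Complex.I := by
    rw [← sub_mul]; congr 1; norm_cast; field_simp; ring
  rw [e, Complex.exp_sub, Complex.exp_pi_mul_I, ← mul_add, mul_sub, Complex.sub_re]
  congr 1
  rw [div_neg, div_one, neg_mul, Complex.neg_re]
  ring

/-- The lower bound splits `2T` as `(T - T(· - π/n)) + (T + T(· - π/n))`: the dipole bound controls
the first part and the second is small. -/
lemma fourierDeviation_bounds (hs : 1 < s) (hα : 0 < α) (hr0 : 0 < r) (hr1 : r < 1)
    (hn : 1 ≤ n) (hk : 2 ≤ n * slope α r n) (ha1 : slope α r n ≤ 1) :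
    fourierDeviation α r β 1 (ENNReal.ofReal s) n ≠ ∞ ∧
    π * (fourierDeviation α r β 1 (ENNReal.ofReal s) n).toReal ≤ exp (-α * (n : ℝ) ^ r) *
      (circleNorm s (modulated n (β * π / 2) (trigSeries (tailCoeff α r n)))).toReal ∧
    exp (-α * (n : ℝ) ^ r) *
      ((circleNorm s (modulated n (β * π / 2) (trigSeries (tailCoeff α r n)))).toReal -
        shiftBound α r s n) ≤ π * (fourierDeviation α r β 1 (ENNReal.ofReal s) n).toReal := by
  have hc := summable_tailCoeff hα hn hk
  have hG := continuous_trigSeries hc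
  have hT := continuous_tailKernel β hc
  have hn' : (0 : ℝ) < n := by exact_mod_cast hn
  have hn1 : (1 : ℝ) ≤ n := by exact_mod_cast hn
  have hN := circleNorm_ne_top (s := s) (continuous_modulated (n := n) (β * π / 2) hG)
  have hup := fourierDeviation_le (β := β) hs hn hc
  have hpn : π / n ≤ π := div_le_self pi_pos.le hn1
  have hlo := circleNorm_sub_shift_le_fourierDeviation (β := β) (s := s) hn hc
    (h := π / n) (by positivity) (by linarith [pi_pos])
  rw [circleNorm_tailKernel] at hup
  have hfin : fourierDeviation α r β 1 (ENNReal.ofReal s) n ≠ ∞ :=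
    (hup.trans_lt (ENNReal.mul_lt_top ENNReal.ofReal_lt_top
      (ENNReal.mul_lt_top ENNReal.ofReal_lt_top hN.lt_top))).ne
  have h0 := shiftBound_nonneg (s := s) hα hr0 hn
  have hsum : circleNorm s (fun x => tailKernel α r β n x + tailKernel α r β n (x - π / n)) ≤
      ENNReal.ofReal (exp (-α * (n : ℝ) ^ r) * shiftBound α r s n) := by
    simp_rw [tailKernel_add_shift β hn]
    rw [circleNorm_const_mul, abs_exp, ENNReal.ofReal_mul (exp_pos _).le]
    gcongr
    refine le_trans (circleNorm_mono fun x => (abs_modulated_le _ x).trans ?_)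
      (circleNorm_tailCoeff_shift_le hs hα hr0 hr1 hn hk ha1 (h := -(π / n)) ?_)
    · rw [norm_sub_rev, sub_eq_add_neg x]
    · rw [abs_neg, abs_of_pos (by positivity)]
      gcongr; linarith [pi_pos]
  have htwo : circleNorm s (fun x => (2 : ℝ) * tailKernel α r β n x) ≤
      circleNorm s (fun x => tailKernel α r β n x - tailKernel α r β n (x - π / n)) +
        circleNorm s (fun x => tailKernel α r β n x + tailKernel α r β n (x - π / n)) := by
    have e : (fun x => (2 : ℝ) * tailKernel α r β n x) = fun x =>
      (tailKernel α r β n x - tailKernel α r β n (x - π / n)) +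
        (tailKernel α r β n x + tailKernel α r β n (x - π / n)) := by ext x; ring
    rw [e]
    exact circleNorm_add_le hs (by fun_prop) (by fun_prop)
  rw [circleNorm_const_mul, circleNorm_tailKernel] at htwo
  rw [circleNorm_const_mul] at hlo
  have hS : circleNorm s (fun x => tailKernel α r β n x - tailKernel α r β n (x - π / n)) ≠ ∞ :=
    circleNorm_ne_top (by fun_prop)
  have g1 := ENNReal.toReal_mono (ENNReal.mul_ne_top ENNReal.ofReal_ne_top
    (ENNReal.mul_ne_top ENNReal.ofReal_ne_top hN)) hup
  have g2 := ENNReal.toReal_mono hfin hlo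
  have g3 := ENNReal.toReal_mono (ENNReal.add_ne_top.2 ⟨hS, ENNReal.ofReal_ne_top⟩)
    (htwo.trans (add_le_add le_rfl hsum))
  have hpi := pi_pos
  rw [ENNReal.toReal_mul, ENNReal.toReal_mul, ENNReal.toReal_ofReal (by positivity),
    ENNReal.toReal_ofReal (exp_pos _).le] at g1
  rw [ENNReal.toReal_mul, abs_of_pos (by positivity), ENNReal.toReal_ofReal (by positivity)] at g2
  rw [ENNReal.toReal_mul, ENNReal.toReal_mul, ENNReal.toReal_add hS ENNReal.ofReal_ne_top,
    ENNReal.toReal_ofReal (by positivity), ENNReal.toReal_ofReal (exp_pos _).le,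
    ENNReal.toReal_ofReal (by positivity), abs_two] at g3
  refine ⟨hfin, ?_, ?_⟩
  · rw [div_mul_eq_mul_div, one_mul, le_div_iff₀ hpi] at g1
    linarith
  · rw [div_mul_eq_mul_div, one_mul, div_le_iff₀ (by positivity)] at g2
    -- Only half of the shift error is needed; the other half is given away.
    have : 0 ≤ exp (-α * (n : ℝ) ^ r) * shiftBound α r s n := by positivity
    linarith

/-- The deviation is close to the mean of the cosine times the norm of the pole kernel. -/
lemma abs_fourierDeviation_sub_le (hs : 1 < s) (hα : 0 < α) (hr0 : 0 < r) (hr1 : r < 1)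
    (hn : 1 ≤ n) (hk : 2 ≤ n * slope α r n) (ha1 : slope α r n ≤ 1) :
    |(fourierDeviation α r β 1 (ENNReal.ofReal s) n).toReal - exp (-α * (n : ℝ) ^ r) *
        (cosMean s * fullPoleNorm s (slope α r n) / π)| ≤
      exp (-α * (n : ℝ) ^ r) * ((14 * π) ^ 2 *
        (1 + slope α r n ^ ((s - 1) * (1 - 1 / s)) / (s - 1) + 1 / (n * slope α r n) *
          (slope α r n ^ (-(1 - 1 / s)) * (s / (s - 1)) ^ (1 / s)))) := by
  have ha := slope_pos hα hr0 hn
  have hn' : (0 : ℝ) < n := by exact_mod_cast hn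
  obtain ⟨-, h1, h2⟩ := fourierDeviation_bounds β hs hα hr0 hr1 hn hk ha1
  have h3 := abs_le.1 (abs_circleNorm_modulated_sub_le hs hα hr0 hr1 hn hk ha1 (β * π / 2))
  obtain ⟨h4, h5⟩ := circleNorm_tailCoeff_bounds hs hα hr0 hr1 hn hk ha1
  have h6 := poleNorm_le_fullPoleNorm hs ha
  have h7 := fullPoleNorm_le_poleNorm_add hs ha
  have h8 := fullPoleNorm_le hs ha
  have hM0 := cosMean_nonneg s
  have hM1 := cosMean_le_one hs
  have hT2 : 0 ≤ slope α r n ^ ((s - 1) * (1 - 1 / s)) / (s - 1) :=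
    div_nonneg (by positivity) (by linarith)
  have hp0 := poleNorm_nonneg s (slope α r n)
  simp only [shiftBound, gapBound] at h2 h3 h4 h5
  set E := (fourierDeviation α r β 1 (ENNReal.ofReal s) n).toReal
  set e := exp (-α * (n : ℝ) ^ r)
  set N := (circleNorm s (modulated n (β * π / 2) (trigSeries (tailCoeff α r n)))).toReal
  set g := (circleNorm s (trigSeries (tailCoeff α r n))).toReal
  set M := cosMean s
  set a := slope α r n
  set κ := poleNorm s a
  set K := fullPoleNorm s a
  set T2 := a ^ ((s - 1) * (1 - 1 / s)) / (s - 1)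
  set T := a ^ (-(1 - 1 / s)) * (s / (s - 1)) ^ (1 / s)
  have hε0 : 0 < 1 / (n * a) := by positivity
  have e1 : 10 / (n * a) * κ = 10 * (1 / (n * a) * κ) := by ring
  have e2 : 8 * π ^ 2 / (n * a) * κ = 8 * π ^ 2 * (1 / (n * a) * κ) := by ring
  rw [e1, e2] at h2 h3
  rw [e1] at h4 h5
  have h9 : 1 / (n * a) * κ ≤ 2 * (1 / (n * a) * T) := by
    have := mul_le_mul_of_nonneg_left (h6.trans h8) hε0.le
    linarith
  set x := 1 / (n * a) * κ
  have hx0 : 0 ≤ x := by positivity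
  set y := 1 / (n * a) * T
  have hpi2 : π ^ 2 ≤ 10 := by nlinarith [pi_lt_d2, pi_pos]
  have hpi4 := pi_lt_four
  have hpi3 := pi_gt_three
  have hgx : 10 * π + 10 * x ≤ 40 + 10 * x := by linarith
  have hxx : 8 * π ^ 2 * x ≤ 80 * x := by nlinarith
  have hA : M * g ≤ M * K + (160 + 10 * x) := by
    have : M * g ≤ M * (K + (160 + 10 * x)) := mul_le_mul_of_nonneg_left (by linarith) hM0
    have : M * (160 + 10 * x) ≤ 1 * (160 + 10 * x) := by gcongr
    linarith
  have hB : M * K ≤ M * g + (162 + 10 * x + 2 * T2) := by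
    have : M * K ≤ M * (g + (162 + 10 * x + 2 * T2)) := mul_le_mul_of_nonneg_left (by linarith) hM0
    have : M * (162 + 10 * x + 2 * T2) ≤ 1 * (162 + 10 * x + 2 * T2) := by gcongr
    linarith
  have he : 0 < e := exp_pos _
  -- The lower estimate is the costlier one, since the shift error enters twice: the total is at
  -- most `322 + 2 T2 + 210 x`, and `x ≤ 2 y`.
  set Y := 500 * (1 + T2 + y) with hY
  have hc1 : N ≤ M * K + Y := by rw [hY]; linarith
  have hc2 : M * K - Y ≤ N - (2 * (10 * π + 10 * x) + 8 * π ^ 2 * x) := by rw [hY]; linarith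
  have hd1 : π * E ≤ e * (M * K + Y) := h1.trans (by gcongr)
  have hd2 : e * (M * K - Y) ≤ π * E := (mul_le_mul_of_nonneg_left hc2 he.le).trans h2
  have hY0 : 0 ≤ 1 + T2 + y := by linarith
  have hYb : e * Y / π ≤ e * ((14 * π) ^ 2 * (1 + T2 + y)) := by
    rw [div_le_iff₀ pi_pos, hY]
    have : 500 ≤ (14 * π) ^ 2 * π := by nlinarith
    calc e * (500 * (1 + T2 + y)) ≤ e * ((14 * π) ^ 2 * π * (1 + T2 + y)) := by gcongr
      _ = _ := by ring
  refine le_trans ?_ hYb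
  have e3 : E - e * (M * K / π) = (π * E - e * (M * K)) / π := by field_simp
  rw [e3, abs_div, abs_of_pos pi_pos]
  gcongr
  rw [abs_le]
  constructor <;> linarith

end Deviation

/-! ### Return to the original parameters -/

lemma slope_rpow {α r : ℝ} {n : ℕ} (hα : 0 < α) (hr0 : 0 < r) (x : ℝ) :
    slope α r n ^ x = (α * r) ^ x * (n : ℝ) ^ ((r - 1) * x) := by
  rw [slope, mul_rpow (by positivity) (by positivity), ← rpow_mul n.cast_nonneg]

lemma main_term_eq {α r s : ℝ} {n : ℕ} (hα : 0 < α) (hr0 : 0 < r) (hs : 1 < s) (hn : 1 ≤ n) :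
    cosMean s * fullPoleNorm s (slope α r n) / π = (n : ℝ) ^ ((1 - r) * (1 - 1 / s)) *
      ((circleNorm s cos).toReal / (π ^ (1 + 1 / s) * (α * r) ^ (1 - 1 / s)) *
        poleIntegral s ^ (1 / s)) := by
  have hαr : 0 < α * r := mul_pos hα hr0
  rw [fullPoleNorm_eq hs (slope_pos hα hr0 hn), cosMean, slope_rpow hα hr0,
    mul_rpow zero_le_two pi_pos.le, rpow_add pi_pos, rpow_one, rpow_neg hαr.le,
    show (r - 1) * -(1 - 1 / s) = (1 - r) * (1 - 1 / s) by ring]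
  have h1 : (2 : ℝ) ^ (1 / s) ≠ 0 := by positivity
  have h2 : π ^ (1 / s) ≠ 0 := by positivity
  have h3 : (α * r) ^ (1 - 1 / s) ≠ 0 := by positivity
  generalize (2 : ℝ) ^ (1 / s) = x at *
  generalize π ^ (1 / s) = y at *
  generalize (α * r) ^ (1 - 1 / s) = z at *
  have := pi_pos.ne'
  field_simp

/-- The last summands agree exactly; the loss is only in the middle one, where the slope is replaced
by its upper bound `α r`. -/
lemma error_term_le {α r s : ℝ} {n : ℕ} (hα : 0 < α) (hr0 : 0 < r) (hr1 : r < 1) (hs : 1 < s)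
    (hn : 1 ≤ n) :
    1 + slope α r n ^ ((s - 1) * (1 - 1 / s)) / (s - 1) + 1 / (n * slope α r n) *
        (slope α r n ^ (-(1 - 1 / s)) * (s / (s - 1)) ^ (1 / s)) ≤
      (n : ℝ) ^ ((1 - r) * (1 - 1 / s)) *
        ((1 + (α * r) ^ ((s - 1) * (1 - 1 / s)) / (s - 1)) *
            (1 / (n : ℝ) ^ ((1 - r) * (1 - 1 / s))) +
          (s / (s - 1)) ^ (1 / s) / (α * r) ^ (1 + (1 - 1 / s)) * (1 / (n : ℝ) ^ r)) := by
  have hαr : 0 < α * r := mul_pos hα hr0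
  have hn1 : (1 : ℝ) ≤ n := by exact_mod_cast hn
  have hn0 : (0 : ℝ) < n := by linarith
  have hs1 : 0 < s - 1 := by linarith
  have ha := slope_pos hα hr0 hn
  have hle : slope α r n ≤ α * r := by
    rw [slope]
    exact mul_le_of_le_one_right hαr.le (rpow_le_one_of_one_le_of_nonpos hn1 (by linarith))
  have hp : 0 ≤ 1 - 1 / s := sub_nonneg.2 ((div_le_one (by linarith)).2 hs.le)
  have h1 : slope α r n ^ ((s - 1) * (1 - 1 / s)) ≤ (α * r) ^ ((s - 1) * (1 - 1 / s)) :=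
    rpow_le_rpow ha.le hle (by positivity)
  have hna : (n : ℝ) * slope α r n = α * r * n ^ r := by
    rw [slope, rpow_sub_one hn0.ne']; field_simp
  have h2 : 1 / (n * slope α r n) *
        (slope α r n ^ (-(1 - 1 / s)) * (s / (s - 1)) ^ (1 / s)) =
      (n : ℝ) ^ ((1 - r) * (1 - 1 / s)) * ((s / (s - 1)) ^ (1 / s) /
        (α * r) ^ (1 + (1 - 1 / s)) * (1 / (n : ℝ) ^ r)) := by
    rw [hna, slope_rpow hα hr0, rpow_add hαr, rpow_one, rpow_neg hαr.le,
      show (r - 1) * -(1 - 1 / s) = (1 - r) * (1 - 1 / s) by ring]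
    have h3 : (α * r) ^ (1 - 1 / s) ≠ 0 := by positivity
    have h4 : (n : ℝ) ^ r ≠ 0 := by positivity
    generalize (α * r) ^ (1 - 1 / s) = z at *
    generalize (n : ℝ) ^ r = w at *
    field_simp
  have h5 : (n : ℝ) ^ ((1 - r) * (1 - 1 / s)) ≠ 0 := by positivity
  have h6 : ∀ c : ℝ, (n : ℝ) ^ ((1 - r) * (1 - 1 / s)) *
      (c * (1 / (n : ℝ) ^ ((1 - r) * (1 - 1 / s)))) = c := fun c => by field_simp
  rw [h2, mul_add, h6]
  gcongr

end PoissonFourier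

end

theorem mainTheorem2 (α r β s s' : ℝ) (n : ℕ)
    (hr0 : 0 < r) (hr1 : r < 1) (hs : 1 < s) (hα : 0 < α)
    (hss' : 1 / s + 1 / s' = 1)
    (hn : PoissonFourier.nZero α r (ENNReal.ofReal s') ≤ n) :
    PoissonFourier.fourierDeviation α r β 1 (ENNReal.ofReal s) n ≠ ∞ ∧
    ∃ γ : ℝ, |γ| ≤ (14 * π) ^ 2 ∧
      (PoissonFourier.fourierDeviation α r β 1 (ENNReal.ofReal s) n).toReal =
        exp (-α * (n : ℝ) ^ r) * (n : ℝ) ^ ((1 - r) / s') *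
          ((PoissonFourier.periodNorm (ENNReal.ofReal s) cos).toReal /
              (π ^ (1 + 1 / s) * (α * r) ^ (1 / s')) *
              (ordinaryHypergeometric (1 / 2 : ℝ) ((3 - s) / 2) (3 / 2) (1 : ℝ)) ^ (1 / s) +
            γ * ((1 + (α * r) ^ ((s - 1) / s') / (s - 1)) * (1 / (n : ℝ) ^ ((1 - r) / s')) +
              s' ^ (1 / s) / (α * r) ^ (1 + 1 / s') * (1 / (n : ℝ) ^ r))) := by
  open PoissonFourier in
  have hs0 : 0 < s := by linarith
  have hs1 : 0 < s - 1 := by linarith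
  have hinv : 1 / s' = 1 - 1 / s := by linarith
  have hs'eq : s' = s / (s - 1) := by
    rw [← one_div_one_div s', hinv]; field_simp
  have hs' : 1 < s' := by rw [hs'eq, one_lt_div hs1]; linarith
  obtain ⟨hn1, hk, ha1⟩ := slope_bounds_of_nZero_le hα hr0 hr1 hs' hn
  refine ⟨(fourierDeviation_bounds β hs hα hr0 hr1 hn1 hk ha1).1, ?_⟩
  have key := abs_fourierDeviation_sub_le β hs hα hr0 hr1 hn1 hk ha1
  rw [main_term_eq hα hr0 hs hn1] at key
  have herr := error_term_le hα hr0 hr1 hs hn1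
  have hn0 : (0 : ℝ) < n := by exact_mod_cast hn1
  have hαr : 0 < α * r := mul_pos hα hr0
  have d1 : (1 - r) / s' = (1 - r) * (1 - 1 / s) := by rw [← hinv]; ring
  have d2 : (s - 1) / s' = (s - 1) * (1 - 1 / s) := by rw [← hinv]; ring
  rw [hypergeometric_eq_poleIntegral hs, d1, d2, hinv, hs'eq]
  change ∃ γ : ℝ, |γ| ≤ (14 * π) ^ 2 ∧
    (fourierDeviation α r β 1 (ENNReal.ofReal s) n).toReal = _ * (n : ℝ) ^ _ *
      ((circleNorm s cos).toReal / _ * _ + _)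
  set Y := (1 + (α * r) ^ ((s - 1) * (1 - 1 / s)) / (s - 1)) *
      (1 / (n : ℝ) ^ ((1 - r) * (1 - 1 / s))) +
    (s / (s - 1)) ^ (1 / s) / (α * r) ^ (1 + (1 - 1 / s)) * (1 / (n : ℝ) ^ r) with hY
  have hYpos : 0 < Y := by positivity
  set ν := (n : ℝ) ^ ((1 - r) * (1 - 1 / s)) with hν
  have hνpos : 0 < ν := by positivity
  set e := exp (-α * (n : ℝ) ^ r)
  have he : 0 < e := exp_pos _
  set Q := (circleNorm s cos).toReal / (π ^ (1 + 1 / s) * (α * r) ^ (1 - 1 / s)) *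
    poleIntegral s ^ (1 / s)
  set E := (fourierDeviation α r β 1 (ENNReal.ofReal s) n).toReal
  -- The required identity forces this value of `γ`, as `e ν Y` is positive.
  refine ⟨(E - e * (ν * Q)) / (e * ν * Y), ?_, ?_⟩
  · rw [abs_div, abs_of_pos (by positivity : 0 < e * ν * Y), div_le_iff₀ (by positivity)]
    refine key.trans ?_
    calc _ ≤ e * ((14 * π) ^ 2 * (ν * Y)) := by gcongr
      _ = _ := by ring
  · field_simp
    ring
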